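/- Let $\mathbb K$ be an involutive extension of $\mathbb C$, i.e. a field extension of $\mathbb C$ equipped with an involutive automorphism $*$ restricting to complex conjugation on $\mathbb C$. Let $q\in\mathbb K^\times$ be not a root of unity, and let $q^{1/2}\in\mathbb K^\times$ be a square root of $q$ with $(q^{1/2})^*=q^{1/2}$. Let $U_q(\mathfrak{sl}_2)$ be the unital $\mathbb K$-algebra generated by $E,F,k,k^{-1}$ with relations $kk^{-1}=k^{-1}k=1$, $kE=q^2Ek$, $kF=q^{-2}Fk$, $EF-FE=(k-k^{-1})/(q-q^{-1})$, with coproduct $\Delta(E)=E\otimes1+k\otimes E$, $\Delta(F)=F\otimes k^{-1}+1\otimes F$, $\Delta(k)=k\otimes k$ and counit $\epsilon(E)=\epsilon(F)=0$, $\epsilon(k)=1$. Let $u_{\alpha\beta}\in U_q(\mathfrak{sl}_2)^*$ be the matrix entries of its representation $$E\mapsto\begin{pmatrix}0&q^{1/2}\\0&0\end{pmatrix},\quad F\mapsto\begin{pmatrix}0&0\\q^{-1/2}&0\end{pmatrix},\quad k\mapsto\begin{pmatrix}q&0\\0&q^{-1}\end{pmatrix},$$ and let $\mathcal O_q(\mathrm{SL}(2))$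 be the algebra generated by the $u_{\alpha\beta}$ inside the dual $U_q(\mathfrak{sl}_2)^*$ with its convolution product. It carries the actions $(x\triangleright y)(w)=y(wx)$ and $(y\triangleleft x)(w)=y(xw)$ of $U_q(\mathfrak{sl}_2)$. Let $D$ be the Drinfeld double of $U_q(\mathfrak{sl}_2)^{\mathrm{cop}}$ and $\mathcal O_q(\mathrm{SL}(2))$, that is, the universal unital algebra generated by copies of the algebras $U_q(\mathfrak{sl}_2)$ and $\mathcal O_q(\mathrm{SL}(2))$ subject to $(x_{(1)}\triangleright y)\,x_{(2)}=x_{(1)}\,(y\triangleleft x_{(2)})$ for all $x\in U_q(\mathfrak{sl}_2)$, $y\in\mathcal O_q(\mathrm{SL}(2))$. Put $\theta=iq^{-1/2}(E-Fk)$, let $U_q(\mathfrak k)$ be the unital subalgebra of $U_q(\mathfrak{sl}_2)$ generated by $\theta$, and let $\mathcal O_q(K\backslash U)=\{y\in\mathcal O_q(\mathrm{SL}(2)) : y\triangleleft\theta=0\}$. The quantized enveloping algebra $U_q(\mathfrak g)$ of $\mathfrak g=\mathfrak{sl}(2,\mathbb R)$ is the subalgebra of $D$ generated by $U_q(\mathfrak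 k)$ and $\mathcal O_q(K\backslash U)$. Let $X,Y,Z\in\mathcal O_q(K\backslash U)$ be defined by $$u^*\begin{pmatrix}0&-1\\1&0\end{pmatrix}u=\begin{pmatrix}iq^{-1}Z&-Y\\X&-iqZ\end{pmatrix},\qquad u^*=\begin{pmatrix}u_{22}&-q^{-1}u_{12}\\-q\,u_{21}&u_{11}\end{pmatrix}.$$ Theorem. The center of $U_q(\mathfrak g)$ is the unital subalgebra generated by the Casimir element $$\Omega=qX+q^{-1}Y+(q-q^{-1})\theta Z,$$ and $\Omega$ is transcendental over $\mathbb K$; that is, the center is the polynomial algebra $\mathbb K[\Omega]$. -/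

import Mathlib

open scoped TensorProduct

noncomputable section

namespace QSL2R

universe u

variable {K : Type u} [Field K]

/-! ## The Drinfeld-Jimbo algebra of `sl(2)` -/

/-- The canonical generators. -/
inductive Gen
  | E | F | k | kinv

/-- The defining relations. The last one is `E F - F E = (k - k⁻¹) / (q - q⁻¹)` with the
denominator (nonzero whenever `q` is not a root of unity) cleared. -/
inductive UqRel (q : Kˣ) : FreeAlgebra K Gen → FreeAlgebra K Gen → Prop
  | k_kinv : UqRel q (FreeAlgebra.ι K Gen.k * FreeAlgebra.ι K Gen.kinv) 1
  | kinv_k : UqRel q (FreeAlgebra.ι K Gen.kinv * FreeAlgebra.ι K Gen.k) 1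
  | k_E : UqRel q (FreeAlgebra.ι K Gen.k * FreeAlgebra.ι K Gen.E)
      (((q : K) ^ 2) • (FreeAlgebra.ι K Gen.E * FreeAlgebra.ι K Gen.k))
  | k_F : UqRel q (FreeAlgebra.ι K Gen.k * FreeAlgebra.ι K Gen.F)
      (((q : K)⁻¹ ^ 2) • (FreeAlgebra.ι K Gen.F * FreeAlgebra.ι K Gen.k))
  | E_F : UqRel q
      (((q : K) - (q : K)⁻¹) • (FreeAlgebra.ι K Gen.E * FreeAlgebra.ι K Gen.F
        - FreeAlgebra.ι K Gen.F * FreeAlgebra.ι K Gen.E))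
      (FreeAlgebra.ι K Gen.k - FreeAlgebra.ι K Gen.kinv)

/-- The quantized enveloping algebra `U_q(sl₂)`. -/
def Uq (q : Kˣ) : Type u := RingQuot (UqRel q)

instance (q : Kˣ) : Ring (Uq q) := inferInstanceAs (Ring (RingQuot (UqRel q)))

instance (q : Kˣ) : Algebra K (Uq q) := inferInstanceAs (Algebra K (RingQuot (UqRel q)))

namespace Uq

/-- The quotient map from the free algebra. -/
def mk (q : Kˣ) : FreeAlgebra K Gen →ₐ[K] Uq q := RingQuot.mkAlgHom K (UqRel q)

/-- The generators of `U_q(sl₂)`. -/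
def gen (q : Kˣ) (g : Gen) : Uq q := mk q (FreeAlgebra.ι K g)

/-- The generator `E`. -/
def E (q : Kˣ) : Uq q := gen q .E
/-- The generator `F`. -/
def F (q : Kˣ) : Uq q := gen q .F
/-- The generator `k`. -/
def k (q : Kˣ) : Uq q := gen q .k
/-- The generator `k⁻¹`. -/
def kinv (q : Kˣ) : Uq q := gen q .kinv

lemma mk_rel (q : Kˣ) {a b : FreeAlgebra K Gen} (h : UqRel q a b) : mk q a = mk q b :=
  RingQuot.mkAlgHom_rel K h

lemma k_mul_kinv (q : Kˣ) : k q * kinv q = 1 := by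
  simpa [k, kinv, gen] using mk_rel q .k_kinv

lemma kinv_mul_k (q : Kˣ) : kinv q * k q = 1 := by
  simpa [k, kinv, gen] using mk_rel q .kinv_k

lemma k_mul_E (q : Kˣ) : k q * E q = ((q : K) ^ 2) • (E q * k q) := by
  simpa [k, E, gen] using mk_rel q .k_E

lemma k_mul_F (q : Kˣ) : k q * F q = ((q : K)⁻¹ ^ 2) • (F q * k q) := by
  simpa [k, F, gen] using mk_rel q .k_F

lemma E_F (q : Kˣ) :
    ((q : K) - (q : K)⁻¹) • (E q * F q - F q * E q) = k q - kinv q := by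
  simpa [k, kinv, E, F, gen] using mk_rel q .E_F

lemma kinv_mul_E (q : Kˣ) : kinv q * E q = ((q : K)⁻¹ ^ 2) • (E q * kinv q) := by
  have h : kinv q * (k q * E q) * kinv q = kinv q * (((q : K) ^ 2) • (E q * k q)) * kinv q := by
    rw [k_mul_E]
  rw [← mul_assoc, kinv_mul_k, one_mul, mul_smul_comm, smul_mul_assoc, mul_assoc, mul_assoc,
    k_mul_kinv, mul_one] at h
  rw [h, smul_smul]
  simp

/-- The universal property: a family of elements satisfying the defining relations induces a
homomorphism of algebras. -/
def lift (q : Kˣ) {A : Type*} [Ring A] [Algebra K A] (e f t t' : A)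
    (h1 : t * t' = 1) (h2 : t' * t = 1)
    (h3 : t * e = ((q : K) ^ 2) • (e * t)) (h4 : t * f = ((q : K)⁻¹ ^ 2) • (f * t))
    (h5 : ((q : K) - (q : K)⁻¹) • (e * f - f * e) = t - t') : Uq q →ₐ[K] A :=
  RingQuot.liftAlgHom K ⟨FreeAlgebra.lift K (Gen.rec e f t t'), by
    rintro _ _ (_ | _ | _ | _ | _) <;> simp [h1, h2, h3, h4, h5]⟩

section lift
variable (q : Kˣ) {A : Type*} [Ring A] [Algebra K A] (e f t t' : A)
    (h1 : t * t' = 1) (h2 : t' * t = 1)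
    (h3 : t * e = ((q : K) ^ 2) • (e * t)) (h4 : t * f = ((q : K)⁻¹ ^ 2) • (f * t))
    (h5 : ((q : K) - (q : K)⁻¹) • (e * f - f * e) = t - t')

lemma lift_gen (g : Gen) :
    lift q e f t t' h1 h2 h3 h4 h5 (gen q g) = Gen.rec e f t t' g :=
  (RingQuot.liftAlgHom_mkAlgHom_apply K _ _ _).trans (FreeAlgebra.lift_ι_apply _ _)

@[simp] lemma lift_E : lift q e f t t' h1 h2 h3 h4 h5 (E q) = e := lift_gen ..
@[simp] lemma lift_F : lift q e f t t' h1 h2 h3 h4 h5 (F q) = f := lift_gen ..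
@[simp] lemma lift_k : lift q e f t t' h1 h2 h3 h4 h5 (k q) = t := lift_gen ..
@[simp] lemma lift_kinv : lift q e f t t' h1 h2 h3 h4 h5 (kinv q) = t' := lift_gen ..

end lift

lemma algHom_ext (q : Kˣ) {A : Type*} [Semiring A] [Algebra K A] {f g : Uq q →ₐ[K] A}
    (hE : f (E q) = g (E q)) (hF : f (F q) = g (F q)) (hk : f (k q) = g (k q))
    (hk' : f (kinv q) = g (kinv q)) : f = g := by
  refine RingQuot.ringQuot_ext' K _ _ (FreeAlgebra.hom_ext (funext fun x => ?_))
  cases x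
  · exact hE
  · exact hF
  · exact hk
  · exact hk'

/-- The coproduct: `Δ(E) = E ⊗ 1 + k ⊗ E`, `Δ(F) = F ⊗ k⁻¹ + 1 ⊗ F`, `Δ(k) = k ⊗ k`. -/
def comulHom (q : Kˣ) : Uq q →ₐ[K] Uq q ⊗[K] Uq q :=
  lift q (E q ⊗ₜ 1 + k q ⊗ₜ E q) (F q ⊗ₜ kinv q + 1 ⊗ₜ F q) (k q ⊗ₜ k q) (kinv q ⊗ₜ kinv q)
    (by simp [k_mul_kinv, Algebra.TensorProduct.one_def])
    (by simp [kinv_mul_k, Algebra.TensorProduct.one_def])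
    (by simp [mul_add, add_mul, k_mul_E, TensorProduct.smul_tmul'])
    (by simp [mul_add, add_mul, k_mul_F, k_mul_kinv, kinv_mul_k, TensorProduct.smul_tmul'])
    (by
      have h : (E q * F q) ⊗ₜ[K] kinv q - (F q * E q) ⊗ₜ[K] kinv q
          + (k q ⊗ₜ[K] (E q * F q) - k q ⊗ₜ[K] (F q * E q)) =
          (E q * F q - F q * E q) ⊗ₜ[K] kinv q + k q ⊗ₜ[K] (E q * F q - F q * E q) := by
        rw [TensorProduct.sub_tmul, TensorProduct.tmul_sub]
      calc _ = ((q : K) - (q : K)⁻¹) • ((E q * F q) ⊗ₜ[K] kinv q - (F q * E q) ⊗ₜ[K] kinv q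
          + (k q ⊗ₜ[K] (E q * F q) - k q ⊗ₜ[K] (F q * E q))) := by
            congr 1
            simp only [mul_add, add_mul, Algebra.TensorProduct.tmul_mul_tmul, one_mul, mul_one,
              k_mul_F, kinv_mul_E, TensorProduct.smul_tmul, TensorProduct.tmul_smul]
            abel
        _ = _ := by
            rw [h, smul_add, TensorProduct.smul_tmul', ← TensorProduct.tmul_smul, E_F,
              TensorProduct.sub_tmul, TensorProduct.tmul_sub]
            abel)

/-- The counit: `ε(E) = ε(F) = 0`, `ε(k) = 1`. -/
def counitHom (q : Kˣ) : Uq q →ₐ[K] K :=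
  lift q 0 0 1 1 (by simp) (by simp) (by simp) (by simp) (by simp)

instance (q : Kˣ) : Bialgebra K (Uq q) :=
  Bialgebra.ofAlgHom (comulHom q) (counitHom q)
    (by
      apply algHom_ext <;>
        simp [comulHom, TensorProduct.add_tmul, TensorProduct.tmul_add, add_assoc,
          Algebra.TensorProduct.one_def])
    (by apply algHom_ext <;> simp [comulHom, counitHom])
    (by apply algHom_ext <;> simp [comulHom, counitHom])

lemma comul_eq (q : Kˣ) (x : Uq q) : Coalgebra.comul (R := K) x = comulHom q x := rfl

lemma counit_eq (q : Kˣ) (x : Uq q) : Coalgebra.counit (R := K) x = counitHom q x := rfl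

end Uq

/-! ## The coordinate algebra `O_q(SL(2))` -/

/-- The algebraic dual of `U_q(sl₂)`, an algebra for the convolution product
`(f * g)(x) = f(x₍₁₎) g(x₍₂₎)`, whose unit is the counit of `U_q(sl₂)`. -/
def Dual (q : Kˣ) : Type u := WithConv (Uq q →ₗ[K] K)

instance (q : Kˣ) : Ring (Dual q) := inferInstanceAs (Ring (WithConv (Uq q →ₗ[K] K)))

instance (q : Kˣ) : Algebra K (Dual q) :=
  inferInstanceAs (Algebra K (WithConv (Uq q →ₗ[K] K)))

namespace Dual

/-- An element of the dual, as a linear form. -/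
def eval (q : Kˣ) : Dual q ≃ₗ[K] (Uq q →ₗ[K] K) where
  toFun f := WithConv.ofConv (A := Uq q →ₗ[K] K) f
  invFun f := WithConv.toConv f
  map_add' _ _ := rfl
  map_smul' _ _ := rfl
  left_inv _ := rfl
  right_inv _ := rfl

variable (q : Kˣ)

@[ext] lemma ext {q : Kˣ} {f g : Dual q} (h : ∀ x, eval q f x = eval q g x) : f = g :=
  (eval q).injective (LinearMap.ext h)

lemma eval_mul (f g : Dual q) (x : Uq q) : eval q (f * g) x =
    LinearMap.mul' K K (TensorProduct.map (eval q f) (eval q g) (Coalgebra.comul (R := K) x)) :=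
  rfl

lemma eval_one (x : Uq q) : eval q 1 x = Coalgebra.counit (R := K) x := rfl

end Dual

/-- The vector representation; `s` stands for the square root of `q`. -/
def vecRep (q s : Kˣ) : Uq q →ₐ[K] Matrix (Fin 2) (Fin 2) K :=
  Uq.lift q !![0, (s : K); 0, 0] !![0, 0; (s : K)⁻¹, 0]
    !![(q : K), 0; 0, (q : K)⁻¹] !![(q : K)⁻¹, 0; 0, (q : K)]
    (by ext i j; fin_cases i <;> fin_cases j <;> simp)
    (by ext i j; fin_cases i <;> fin_cases j <;> simp)
    (by ext i j; fin_cases i <;> fin_cases j <;> simp; field_simp)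
    (by ext i j; fin_cases i <;> fin_cases j <;> simp; field_simp)
    (by ext i j; fin_cases i <;> fin_cases j <;> simp)

/-- The matrix coefficient `u_{ij} : x ↦ (vecRep x)_{ij}` of the vector representation. -/
def coeff (q s : Kˣ) (i j : Fin 2) : Dual q :=
  (Dual.eval q).symm ((Matrix.entryLinearMap K K i j) ∘ₗ (vecRep q s).toLinearMap)

@[simp] lemma eval_coeff (q s : Kˣ) (i j : Fin 2) (x : Uq q) :
    Dual.eval q (coeff q s i j) x = vecRep q s x i j := rfl

/-- `O_q(SL(2))`: the algebra generated by the matrix entries `u_{ij}`, realized inside the dual of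
`U_q(sl₂)` through the canonical non-degenerate pairing. (For `q` not a root of unity this is the
algebra of all matrix coefficients of type 1 finite dimensional representations.) -/
def Oq (q s : Kˣ) : Subalgebra K (Dual q) :=
  Algebra.adjoin K (Set.range fun p : Fin 2 × Fin 2 => coeff q s p.1 p.2)

/-- The left action of `U_q(sl₂)` on its dual: `x ▷ f = f₍₁₎ ⟨x, f₍₂₎⟩`, that is
`(x ▷ f)(w) = f(w x)`. -/
def dualL (q : Kˣ) : Uq q →ₗ[K] Dual q →ₗ[K] Dual q :=
  LinearMap.mk₂ K (fun x f => (Dual.eval q).symm (Dual.eval q f ∘ₗ LinearMap.mulRight K x))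
    (by intros; ext; simp [mul_add]) (by intros; ext; simp)
    (by intros; ext; simp) (by intros; ext; simp)

/-- The right action of `U_q(sl₂)` on its dual: `f ◁ x = ⟨x, f₍₁₎⟩ f₍₂₎`, that is
`(f ◁ x)(w) = f(x w)`. The algebra element is the first argument. -/
def dualR (q : Kˣ) : Uq q →ₗ[K] Dual q →ₗ[K] Dual q :=
  LinearMap.mk₂ K (fun x f => (Dual.eval q).symm (Dual.eval q f ∘ₗ LinearMap.mulLeft K x))
    (by intros; ext; simp [add_mul]) (by intros; ext; simp)
    (by intros; ext; simp) (by intros; ext; simp)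

@[simp] lemma eval_dualL (q : Kˣ) (x w : Uq q) (f : Dual q) :
    Dual.eval q (dualL q x f) w = Dual.eval q f (w * x) := rfl

@[simp] lemma eval_dualR (q : Kˣ) (x w : Uq q) (f : Dual q) :
    Dual.eval q (dualR q x f) w = Dual.eval q f (x * w) := rfl

lemma map_mul_tmul (q : Kˣ) (f g : Dual q) (a b : Uq q) (w : Uq q ⊗[K] Uq q) :
    LinearMap.mul' K K (TensorProduct.map (Dual.eval q f) (Dual.eval q g) (w * a ⊗ₜ b)) =
      LinearMap.mul' K K (TensorProduct.map (Dual.eval q (dualL q a f))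
        (Dual.eval q (dualL q b g)) w) := by
  induction w with
  | zero => simp
  | tmul x y => simp
  | add x y hx hy => simp only [add_mul, map_add, hx, hy]

lemma map_tmul_mul (q : Kˣ) (f g : Dual q) (a b : Uq q) (w : Uq q ⊗[K] Uq q) :
    LinearMap.mul' K K (TensorProduct.map (Dual.eval q f) (Dual.eval q g) (a ⊗ₜ b * w)) =
      LinearMap.mul' K K (TensorProduct.map (Dual.eval q (dualR q a f))
        (Dual.eval q (dualR q b g)) w) := by
  induction w with
  | zero => simp
  | tmul x y => simp
  | add x y hx hy => simp only [mul_add, map_add, hx, hy]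

lemma dualL_mul (q : Kˣ) (x : Uq q) (f g : Dual q) :
    dualL q x (f * g) = LinearMap.mul' K (Dual q)
      (TensorProduct.map ((dualL q).flip f) ((dualL q).flip g) (Coalgebra.comul (R := K) x)) := by
  suffices h : ∀ (t : Uq q ⊗[K] Uq q) (w : Uq q),
      LinearMap.mul' K K (TensorProduct.map (Dual.eval q f) (Dual.eval q g)
        (Coalgebra.comul (R := K) w * t)) =
        Dual.eval q (LinearMap.mul' K (Dual q)
          (TensorProduct.map ((dualL q).flip f) ((dualL q).flip g) t)) w by
    ext w
    rw [eval_dualL, Dual.eval_mul, Bialgebra.comul_mul, h]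
  intro t w
  induction t with
  | zero => simp
  | tmul a b => rw [map_mul_tmul]; simp [Dual.eval_mul]
  | add x y hx hy => simp only [mul_add, map_add, hx, hy, LinearMap.add_apply]

lemma dualR_mul (q : Kˣ) (x : Uq q) (f g : Dual q) :
    dualR q x (f * g) = LinearMap.mul' K (Dual q)
      (TensorProduct.map ((dualR q).flip f) ((dualR q).flip g) (Coalgebra.comul (R := K) x)) := by
  suffices h : ∀ (t : Uq q ⊗[K] Uq q) (w : Uq q),
      LinearMap.mul' K K (TensorProduct.map (Dual.eval q f) (Dual.eval q g)
        (t * Coalgebra.comul (R := K) w)) =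
        Dual.eval q (LinearMap.mul' K (Dual q)
          (TensorProduct.map ((dualR q).flip f) ((dualR q).flip g) t)) w by
    ext w
    rw [eval_dualR, Dual.eval_mul, Bialgebra.comul_mul, h]
  intro t w
  induction t with
  | zero => simp
  | tmul a b => rw [map_tmul_mul]; simp [Dual.eval_mul]
  | add x y hx hy => simp only [add_mul, map_add, hx, hy, LinearMap.add_apply]

lemma dualL_one (q : Kˣ) (x : Uq q) :
    dualL q x 1 = (Coalgebra.counit (R := K) x) • (1 : Dual q) := by
  ext w
  simp [Dual.eval_one, mul_comm]

lemma dualR_one (q : Kˣ) (x : Uq q) :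
    dualR q x 1 = (Coalgebra.counit (R := K) x) • (1 : Dual q) := by
  ext w
  simp [Dual.eval_one]

lemma dualL_coeff (q s : Kˣ) (x : Uq q) (i j : Fin 2) :
    dualL q x (coeff q s i j) = ∑ l, vecRep q s x l j • coeff q s i l := by
  ext w
  simp [Matrix.mul_apply, mul_comm]

lemma dualR_coeff (q s : Kˣ) (x : Uq q) (i j : Fin 2) :
    dualR q x (coeff q s i j) = ∑ l, vecRep q s x i l • coeff q s l j := by
  ext w
  simp [Matrix.mul_apply]

lemma coeff_mem (q s : Kˣ) (i j : Fin 2) : coeff q s i j ∈ Oq q s :=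
  Algebra.subset_adjoin ⟨(i, j), rfl⟩

lemma mul'_map_mem (q s : Kˣ) (a b : Uq q →ₗ[K] Dual q) (ha : ∀ x, a x ∈ Oq q s)
    (hb : ∀ x, b x ∈ Oq q s) (t : Uq q ⊗[K] Uq q) :
    LinearMap.mul' K (Dual q) (TensorProduct.map a b t) ∈ Oq q s := by
  induction t with
  | zero => simp
  | tmul x y => simpa using mul_mem (ha x) (hb y)
  | add x y hx hy => simpa using add_mem hx hy

lemma dualL_mem (q s : Kˣ) (x : Uq q) {f : Dual q} (hf : f ∈ Oq q s) :
    dualL q x f ∈ Oq q s := by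
  induction hf using Algebra.adjoin_induction generalizing x with
  | mem f hf =>
    obtain ⟨⟨i, j⟩, rfl⟩ := hf
    rw [dualL_coeff]
    exact sum_mem fun l _ => Subalgebra.smul_mem _ (coeff_mem q s i l) _
  | algebraMap r =>
    rw [Algebra.algebraMap_eq_smul_one, map_smul, dualL_one]
    exact Subalgebra.smul_mem _ (Subalgebra.smul_mem _ (one_mem _) _) _
  | add f g _ _ hf hg => rw [map_add]; exact add_mem (hf x) (hg x)
  | mul f g _ _ hf hg => rw [dualL_mul]; exact mul'_map_mem q s _ _ hf hg _

lemma dualR_mem (q s : Kˣ) (x : Uq q) {f : Dual q} (hf : f ∈ Oq q s) :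
    dualR q x f ∈ Oq q s := by
  induction hf using Algebra.adjoin_induction generalizing x with
  | mem f hf =>
    obtain ⟨⟨i, j⟩, rfl⟩ := hf
    rw [dualR_coeff]
    exact sum_mem fun l _ => Subalgebra.smul_mem _ (coeff_mem q s l j) _
  | algebraMap r =>
    rw [Algebra.algebraMap_eq_smul_one, map_smul, dualR_one]
    exact Subalgebra.smul_mem _ (Subalgebra.smul_mem _ (one_mem _) _) _
  | add f g _ _ hf hg => rw [map_add]; exact add_mem (hf x) (hg x)
  | mul f g _ _ hf hg => rw [dualR_mul]; exact mul'_map_mem q s _ _ hf hg _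

/-- The left action `x ▷ y` of `x : U_q(sl₂)` on `y : O_q(SL(2))`. -/
def actL (q s : Kˣ) : Uq q →ₗ[K] Oq q s →ₗ[K] Oq q s :=
  LinearMap.mk₂ K (fun x y => ⟨dualL q x y, dualL_mem q s x y.2⟩)
    (by intros; ext1; simp) (by intros; ext1; simp)
    (by intros; ext1; simp) (by intros; ext1; simp)

/-- The right action `y ◁ x` of `x : U_q(sl₂)` on `y : O_q(SL(2))`, with `x` as first argument. -/
def actR (q s : Kˣ) : Uq q →ₗ[K] Oq q s →ₗ[K] Oq q s :=
  LinearMap.mk₂ K (fun x y => ⟨dualR q x y, dualR_mem q s x y.2⟩)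
    (by intros; ext1; simp) (by intros; ext1; simp)
    (by intros; ext1; simp) (by intros; ext1; simp)

@[simp] lemma coe_actL (q s : Kˣ) (x : Uq q) (y : Oq q s) :
    (actL q s x y : Dual q) = dualL q x y := rfl

@[simp] lemma coe_actR (q s : Kˣ) (x : Uq q) (y : Oq q s) :
    (actR q s x y : Dual q) = dualR q x y := rfl

/-! ## The Drinfeld double -/

/-- The free algebra on the vector space `U_q(sl₂) × O_q(SL(2))`. -/
abbrev PreDouble (q s : Kˣ) : Type u := TensorAlgebra K (Uq q × Oq q s)

/-- The copy of `U_q(sl₂)` in the free algebra. -/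
def preU (q s : Kˣ) : Uq q →ₗ[K] PreDouble q s :=
  TensorAlgebra.ι K ∘ₗ LinearMap.inl K (Uq q) (Oq q s)

/-- The copy of `O_q(SL(2))` in the free algebra. -/
def preO (q s : Kˣ) : Oq q s →ₗ[K] PreDouble q s :=
  TensorAlgebra.ι K ∘ₗ LinearMap.inr K (Uq q) (Oq q s)

/-- The relations of the double: `U_q(sl₂)` and `O_q(SL(2))` are unital subalgebras, subject to the
exchange relation `(x₍₁₎ ▷ y) x₍₂₎ = x₍₁₎ (y ◁ x₍₂₎)`, that is
`⟨x₍₁₎, y₍₂₎⟩ y₍₁₎ x₍₂₎ = ⟨x₍₂₎, y₍₁₎⟩ x₍₁₎ y₍₂₎`, for `x ∈ U_q(sl₂)` and `y ∈ O_q(SL(2))`. -/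
inductive DoubleRel (q s : Kˣ) : PreDouble q s → PreDouble q s → Prop
  | one_U : DoubleRel q s (preU q s 1) 1
  | mul_U (x x' : Uq q) : DoubleRel q s (preU q s (x * x')) (preU q s x * preU q s x')
  | one_O : DoubleRel q s (preO q s 1) 1
  | mul_O (y y' : Oq q s) : DoubleRel q s (preO q s (y * y')) (preO q s y * preO q s y')
  | exchange (x : Uq q) (y : Oq q s) : DoubleRel q s
      (LinearMap.mul' K (PreDouble q s)
        (TensorProduct.map (preO q s ∘ₗ (actL q s).flip y) (preU q s)
          (Coalgebra.comul (R := K) x)))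
      (LinearMap.mul' K (PreDouble q s)
        (TensorProduct.map (preU q s) (preO q s ∘ₗ (actR q s).flip y)
          (Coalgebra.comul (R := K) x)))

/-- The Drinfeld double of `U_q(sl₂)` (with the opposite coproduct) and `O_q(SL(2))` with respect to
their canonical skew-pairing: the universal unital algebra containing both and in which the exchange
relation holds. -/
def Double (q s : Kˣ) : Type u := RingQuot (DoubleRel q s)

instance (q s : Kˣ) : Ring (Double q s) := inferInstanceAs (Ring (RingQuot (DoubleRel q s)))

instance (q s : Kˣ) : Algebra K (Double q s) :=
  inferInstanceAs (Algebra K (RingQuot (DoubleRel q s)))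

namespace Double

/-- The quotient map from the free algebra. -/
def mk (q s : Kˣ) : PreDouble q s →ₐ[K] Double q s := RingQuot.mkAlgHom K (DoubleRel q s)

lemma mk_rel (q s : Kˣ) {a b : PreDouble q s} (h : DoubleRel q s a b) : mk q s a = mk q s b :=
  RingQuot.mkAlgHom_rel K h

/-- The natural homomorphism from `U_q(sl₂)` to the double. -/
def ofU (q s : Kˣ) : Uq q →ₐ[K] Double q s :=
  AlgHom.ofLinearMap ((mk q s).toLinearMap ∘ₗ preU q s)
    (by simpa using mk_rel q s .one_U)
    (fun x x' => by simpa using mk_rel q s (.mul_U x x'))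

/-- The natural homomorphism from `O_q(SL(2))` to the double. -/
def ofO (q s : Kˣ) : Oq q s →ₐ[K] Double q s :=
  AlgHom.ofLinearMap ((mk q s).toLinearMap ∘ₗ preO q s)
    (by simpa using mk_rel q s .one_O)
    (fun y y' => by simpa using mk_rel q s (.mul_O y y'))

end Double

/-! ## The quantized enveloping algebra of `sl(2, ℝ)` -/

/-- The matrix `u = (u_{ij})` with entries in `O_q(SL(2))`. -/
def uMat (q s : Kˣ) : Matrix (Fin 2) (Fin 2) (Oq q s) :=
  Matrix.of fun i j => ⟨coeff q s i j, coeff_mem q s i j⟩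

lemma actR_k_u_zero (q s : Kˣ) (j : Fin 2) :
    actR q s (Uq.k q) (uMat q s 0 j) = (q : K) • uMat q s 0 j := by
  ext1
  simp [uMat, dualR_coeff, vecRep]

lemma actR_k_u_one (q s : Kˣ) (j : Fin 2) :
    actR q s (Uq.k q) (uMat q s 1 j) = (q : K)⁻¹ • uMat q s 1 j := by
  ext1
  simp [uMat, dualR_coeff, vecRep]

/-- `u^* = diag(1, q) adj(u) diag(1, q⁻¹)`, where `adj !![a, b; c, d] = !![d, -b; -c, a]`. -/
def uStar (q s : Kˣ) : Matrix (Fin 2) (Fin 2) (Oq q s) :=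
  !![uMat q s 1 1, -((q : K)⁻¹ • uMat q s 0 1); -((q : K) • uMat q s 1 0), uMat q s 0 0]

/-- The matrix `u^* !![0, -1; 1, 0] u = !![i q⁻¹ Z, -Y; X, -i q Z]`. -/
def xyzMat (q s : Kˣ) : Matrix (Fin 2) (Fin 2) (Oq q s) :=
  uStar q s * !![0, -1; 1, 0] * uMat q s

/-- The element `X` of `O_q(K\U)`. -/
def X (q s : Kˣ) : Oq q s := xyzMat q s 1 0

/-- The element `Y` of `O_q(K\U)`. -/
def Y (q s : Kˣ) : Oq q s := -xyzMat q s 0 1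

lemma X_eq (q s : Kˣ) : X q s =
    uMat q s 0 0 * uMat q s 0 0 + (q : K) • (uMat q s 1 0 * uMat q s 1 0) := by
  simp only [X, xyzMat, uStar, Matrix.mul_apply, Fin.sum_univ_two, Matrix.of_apply,
    Matrix.cons_val_zero, Matrix.cons_val_one, mul_zero, mul_one, mul_neg, neg_mul, neg_neg,
    zero_add, add_zero, smul_zero, neg_zero,
    smul_neg, neg_neg, smul_mul_assoc]

lemma Y_eq (q s : Kˣ) : Y q s =
    uMat q s 1 1 * uMat q s 1 1 + (q : K)⁻¹ • (uMat q s 0 1 * uMat q s 0 1) := by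
  simp only [Y, xyzMat, uStar, Matrix.mul_apply, Fin.sum_univ_two, Matrix.of_apply,
    Matrix.cons_val_zero, Matrix.cons_val_one, mul_zero, mul_one, mul_neg, neg_mul, neg_neg,
    zero_add, add_zero, smul_zero, neg_zero,
    smul_mul_assoc, neg_add_rev]

section Main

variable [Algebra ℂ K]

/-- The imaginary unit of `K`. -/
def im (K : Type u) [Field K] [Algebra ℂ K] : K := algebraMap ℂ K Complex.I

/-- `θ = i q^{-1/2} (E - F k)`. -/
def theta (q s : Kˣ) : Uq q :=
  (im K * (s : K)⁻¹) • (Uq.E q - Uq.F q * Uq.k q)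

/-- `U_q(𝔨)`: the unital subalgebra of `U_q(sl₂)` generated by `θ`. -/
def Uk (q s : Kˣ) : Subalgebra K (Uq q) := Algebra.adjoin K {theta q s}

/-- `O_q(K\U) = {y ∈ O_q(SL(2)) | y ◁ θ = 0}`. -/
def OqKU (q s : Kˣ) : Set (Oq q s) := {y | actR q s (theta q s) y = 0}

/-- `U_q(𝔤)`: the subalgebra of the Drinfeld double generated by `U_q(𝔨)` and `O_q(K\U)`. -/
def Ug (q s : Kˣ) : Subalgebra K (Double q s) :=
  Algebra.adjoin K (Double.ofU q s '' (Uk q s) ∪ Double.ofO q s '' (OqKU q s))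

/-- The element `Z` of `O_q(K\U)`: it satisfies `i q⁻¹ Z = xyzMat 0 0`. -/
def Z (q s : Kˣ) : Oq q s := -(im K * (q : K)) • xyzMat q s 0 0

lemma comul_theta (q s : Kˣ) : Coalgebra.comul (R := K) (theta q s) =
    theta q s ⊗ₜ 1 + Uq.k q ⊗ₜ theta q s := by
  simp only [Uq.comul_eq, theta, Uq.comulHom, map_smul, map_sub, map_mul, Uq.lift_E, Uq.lift_F,
    Uq.lift_k, add_mul, Algebra.TensorProduct.tmul_mul_tmul, Uq.kinv_mul_k, one_mul,
    TensorProduct.smul_tmul, TensorProduct.tmul_smul, TensorProduct.sub_tmul,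
    TensorProduct.tmul_sub]
  rw [← smul_add]
  congr 1
  abel

lemma actR_theta_mul (q s : Kˣ) (y y' : Oq q s) : actR q s (theta q s) (y * y') =
    actR q s (theta q s) y * y' + actR q s (Uq.k q) y * actR q s (theta q s) y' := by
  have h1 : dualR q 1 (y' : Dual q) = y' := by ext w; simp
  ext1
  simp [dualR_mul, comul_theta, h1]

lemma actR_theta_u_zero (q s : Kˣ) (j : Fin 2) :
    actR q s (theta q s) (uMat q s 0 j) = im K • uMat q s 1 j := by
  ext1
  simp [uMat, dualR_coeff, theta, vecRep, smul_smul]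

lemma actR_theta_u_one (q s : Kˣ) (hs : s ^ 2 = q) (j : Fin 2) :
    actR q s (theta q s) (uMat q s 1 j) = -im K • uMat q s 0 j := by
  subst hs
  ext1
  have hs0 : (s : K) ≠ 0 := s.ne_zero
  simp [uMat, dualR_coeff, theta, vecRep, smul_smul]
  field_simp

lemma Z_eq (q s : Kˣ) : Z q s =
    im K • ((q : K) • (uMat q s 1 1 * uMat q s 1 0) + uMat q s 0 1 * uMat q s 0 0) := by
  simp only [Z, xyzMat, uStar, Matrix.mul_apply, Fin.sum_univ_two, Matrix.of_apply,
    Matrix.cons_val_zero, Matrix.cons_val_one, mul_zero, mul_one, mul_neg, neg_mul,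
    zero_add, add_zero, smul_zero, neg_zero,
    smul_mul_assoc]
  have hq : (q : K) ≠ 0 := q.ne_zero
  match_scalars <;> field_simp

lemma X_mem (q s : Kˣ) (hs : s ^ 2 = q) : X q s ∈ OqKU q s := by
  have hq : (q : K) ≠ 0 := q.ne_zero
  change actR q s (theta q s) (X q s) = 0
  simp only [X_eq, map_add, map_smul, actR_theta_mul, actR_theta_u_zero, actR_theta_u_one q s hs,
    actR_k_u_zero, actR_k_u_one, smul_mul_assoc, mul_smul_comm]
  match_scalars <;> field_simp <;> ring

lemma Y_mem (q s : Kˣ) (hs : s ^ 2 = q) : Y q s ∈ OqKU q s := by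
  have hq : (q : K) ≠ 0 := q.ne_zero
  change actR q s (theta q s) (Y q s) = 0
  simp only [Y_eq, map_add, map_smul, actR_theta_mul, actR_theta_u_zero, actR_theta_u_one q s hs,
    actR_k_u_zero, actR_k_u_one, smul_mul_assoc, mul_smul_comm]
  match_scalars <;> field_simp <;> ring

lemma Z_mem (q s : Kˣ) (hs : s ^ 2 = q) : Z q s ∈ OqKU q s := by
  have hq : (q : K) ≠ 0 := q.ne_zero
  change actR q s (theta q s) (Z q s) = 0
  simp only [Z_eq, map_add, map_smul, actR_theta_mul, actR_theta_u_zero, actR_theta_u_one q s hs,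
    actR_k_u_zero, actR_k_u_one, smul_mul_assoc, mul_smul_comm]
  match_scalars <;> field_simp <;> ring

/-- The element `θ` of `U_q(𝔤)`. -/
def gTheta (q s : Kˣ) : Ug q s :=
  ⟨Double.ofU q s (theta q s),
    Algebra.subset_adjoin (.inl ⟨_, Algebra.subset_adjoin rfl, rfl⟩)⟩

/-- The element of `U_q(𝔤)` given by an element of `O_q(K\U)`. -/
def gO (q s : Kˣ) (y : Oq q s) (hy : y ∈ OqKU q s) : Ug q s :=
  ⟨Double.ofO q s y, Algebra.subset_adjoin (.inr ⟨y, hy, rfl⟩)⟩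

/-- The Casimir element `Ω = q X + q⁻¹ Y + (q - q⁻¹) θ Z` of `U_q(𝔤)`, where `s` is a square root
of `q`. -/
def casimir (q s : Kˣ) (hs : s ^ 2 = q) : Ug q s :=
  (q : K) • gO q s (X q s) (X_mem q s hs) + (q : K)⁻¹ • gO q s (Y q s) (Y_mem q s hs)
    + ((q : K) - (q : K)⁻¹) • (gTheta q s * gO q s (Z q s) (Z_mem q s hs))

end Main

end QSL2R

end

/-!
The exchange relation for `θ`, whose coproduct is `θ ⊗ 1 + k ⊗ θ`, and `y ∈ O_q(K\U)` reads
`θ y = σ(y) θ + δ(y)` with `σ = k ▷` and `δ = θ ▷` (`theta_mul_ofO`). Hence `U_q(𝔤)` is filtered by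
the degree in `θ`, with coefficients in `O_q(K\U)` (`exists_mem_fil`). The coefficients are unique
(`eq_zero_of_ofO_mul_theta_pow_mem`): the double is made to act on sequences in `O_q(SL(2))`, the
module induced from an infinite dimensional representation of `U_q(sl₂)` in which `E` is a backward
shift (`repD`), and there the powers of `θ` can be separated.

What is needed about `O_q(K\U)` follows from evaluating its elements at the elements `F^i k^j`.
Since `U_q(sl₂)` is the sum of `θ U_q(sl₂)` and the span of the `F^i k^j`, these values determine an
element of `O_q(K\U)` (`eq_zero_of_pair_eq_zero`). The values of `Y` are concentrated in degree
`i = 0` and those of `Z` in degree `i = 1`, so that the coproduct of `F^i k^j` gives simple formulas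
for the products with `Y` and `Z`. They show that `y Z = Z σ(y)` (`mul_Z`) with `Z` cancellable, and
that an element commuting with `Z`, and with `Y` up to the factor `q^{-2N}`, is a multiple of `Z^N`
(`eq_smul_Z_pow`).

The Casimir element is `Ω = (q - q⁻¹) Z θ + W` with `W = q⁻¹ X + q Y`. It commutes with `θ` by a
direct computation. Its commutator with `y ∈ O_q(K\U)` is
`T(y) = W y - y W + (q - q⁻¹) Z δ(y)`, again in `O_q(K\U)`. The derivation `T` kills `Z`, so
applying it to `y Z = Z σ(y)` shows that it commutes with `σ`. But `T` is a sum of two operators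
which multiply `k`-weights by `q²` and by `q⁻²`, and such a sum can commute with `σ` only if it vanishes
(`twistedAd_theta_eq_zero`). So no generators and relations of `O_q(K\U)` are required.

Finally let `z` be central of degree `N` in `θ`. Comparing leading coefficients in the commutators
of `z` with `Z` and `Y` shows that the leading coefficient of `z` is a multiple of `Z^N`, hence of
that of `Ω^N`, and subtracting a multiple of `Ω^N` lowers the degree (`mem_adjoin_of_commute`). The
same leading coefficients show that the powers of `Ω` are linearly independent.
-/

open scoped TensorProduct

noncomputable section

namespace QSL2R

universe u

variable {K : Type u} [Field K]

/-! ### The algebra `U_q(sl₂)` and its actions on the coordinate algebra -/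

lemma q_sub_inv_ne_zero {q : Kˣ} (hq : ∀ n : ℕ, 0 < n → q ^ n ≠ 1) :
    (q : K) - (q : K)⁻¹ ≠ 0 := by
  intro h
  have h1 : (q : K) ≠ 0 := q.ne_zero
  apply hq 2 two_pos
  ext
  push_cast
  field_simp at h
  linear_combination h

lemma q_pow_ne_one {q : Kˣ} (hq : ∀ n : ℕ, 0 < n → q ^ n ≠ 1) {n : ℕ} (hn : 0 < n) :
    (q : K) ^ n ≠ 1 := by
  exact_mod_cast fun h => hq n hn (Units.ext (by simpa using h))

lemma zpow_injective_of_pow_ne_one {q : Kˣ} (hq : ∀ n : ℕ, 0 < n → q ^ n ≠ 1) :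
    Function.Injective fun n : ℤ => q ^ n :=
  injective_zpow_iff_not_isOfFinOrder.2 fun h => by
    obtain ⟨n, hn, h⟩ := isOfFinOrder_iff_pow_eq_one.1 h
    exact hq n hn h

namespace Uq

lemma induction_on (q : Kˣ) {P : Uq q → Prop} (x : Uq q)
    (hc : ∀ r : K, P (algebraMap K _ r)) (hE : P (E q)) (hF : P (F q)) (hk : P (k q))
    (hk' : P (kinv q))
    (ha : ∀ x y, P x → P y → P (x + y)) (hm : ∀ x y, P x → P y → P (x * y)) : P x := by
  obtain ⟨x, rfl⟩ := RingQuot.mkAlgHom_surjective K (UqRel q) x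
  change P (mk q x)
  induction x using FreeAlgebra.induction with
  | grade0 r => rw [AlgHom.commutes]; exact hc r
  | grade1 g =>
    cases g
    exacts [hE, hF, hk, hk']
  | mul x y hx hy => rw [map_mul]; exact hm _ _ hx hy
  | add x y hx hy => rw [map_add]; exact ha _ _ hx hy

/-- The generator `k` as a unit. -/
def kUnit (q : Kˣ) : (Uq q)ˣ := ⟨k q, kinv q, k_mul_kinv q, kinv_mul_k q⟩

@[simp] lemma coe_kUnit (q : Kˣ) : (kUnit q : Uq q) = k q := rfl

lemma coe_kUnit_inv (q : Kˣ) : ((kUnit q)⁻¹ : (Uq q)ˣ) = kinv q := rfl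

lemma comul_E (q : Kˣ) : Coalgebra.comul (R := K) (E q) = E q ⊗ₜ 1 + k q ⊗ₜ E q := by
  simp [comul_eq, comulHom]

lemma comul_F (q : Kˣ) : Coalgebra.comul (R := K) (F q) = F q ⊗ₜ kinv q + 1 ⊗ₜ F q := by
  simp [comul_eq, comulHom]

lemma comul_k (q : Kˣ) : Coalgebra.comul (R := K) (k q) = k q ⊗ₜ k q := by
  simp [comul_eq, comulHom]

lemma comul_kinv (q : Kˣ) : Coalgebra.comul (R := K) (kinv q) = kinv q ⊗ₜ kinv q := by
  simp [comul_eq, comulHom]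

@[simp] lemma counit_E (q : Kˣ) : Coalgebra.counit (R := K) (E q) = 0 := by
  simp [counit_eq, counitHom]

@[simp] lemma counit_F (q : Kˣ) : Coalgebra.counit (R := K) (F q) = 0 := by
  simp [counit_eq, counitHom]

@[simp] lemma counit_k (q : Kˣ) : Coalgebra.counit (R := K) (k q) = 1 := by
  simp [counit_eq, counitHom]

@[simp] lemma counit_kinv (q : Kˣ) : Coalgebra.counit (R := K) (kinv q) = 1 := by
  simp [counit_eq, counitHom]

lemma kinv_mul_F (q : Kˣ) : kinv q * F q = ((q : K) ^ 2) • (F q * kinv q) := by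
  have h : kinv q * (k q * F q) * kinv q =
      kinv q * (((q : K)⁻¹ ^ 2) • (F q * k q)) * kinv q := by
    rw [k_mul_F]
  rw [← mul_assoc, kinv_mul_k, one_mul, mul_smul_comm, smul_mul_assoc, mul_assoc, mul_assoc,
    k_mul_kinv, mul_one] at h
  rw [h, smul_smul]
  simp

end Uq

lemma actL_one_left (q s : Kˣ) (y : Oq q s) : actL q s 1 y = y := by
  ext; simp

lemma actR_one_left (q s : Kˣ) (y : Oq q s) : actR q s 1 y = y := by
  ext; simp

lemma actL_mul_left (q s : Kˣ) (x x' : Uq q) (y : Oq q s) :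
    actL q s (x * x') y = actL q s x (actL q s x' y) := by
  ext; simp [mul_assoc]

lemma actR_mul_left (q s : Kˣ) (x x' : Uq q) (y : Oq q s) :
    actR q s (x * x') y = actR q s x' (actR q s x y) := by
  ext; simp [mul_assoc]

lemma actR_actL (q s : Kˣ) (x x' : Uq q) (y : Oq q s) :
    actR q s x (actL q s x' y) = actL q s x' (actR q s x y) := by
  ext; simp [mul_assoc]

@[simp] lemma actL_one (q s : Kˣ) (x : Uq q) :
    actL q s x 1 = Coalgebra.counit (R := K) x • (1 : Oq q s) := by
  ext1; simp [dualL_one]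

@[simp] lemma actR_one (q s : Kˣ) (x : Uq q) :
    actR q s x 1 = Coalgebra.counit (R := K) x • (1 : Oq q s) := by
  ext1; simp [dualR_one]

lemma actL_k_mul (q s : Kˣ) (y y' : Oq q s) : actL q s (Uq.k q) (y * y') =
    actL q s (Uq.k q) y * actL q s (Uq.k q) y' := by
  ext1; simp [dualL_mul, Uq.comul_k]

lemma actL_kinv_mul (q s : Kˣ) (y y' : Oq q s) : actL q s (Uq.kinv q) (y * y') =
    actL q s (Uq.kinv q) y * actL q s (Uq.kinv q) y' := by
  ext1; simp [dualL_mul, Uq.comul_kinv]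

lemma actR_k_mul (q s : Kˣ) (y y' : Oq q s) : actR q s (Uq.k q) (y * y') =
    actR q s (Uq.k q) y * actR q s (Uq.k q) y' := by
  ext1; simp [dualR_mul, Uq.comul_k]

lemma actR_kinv_mul (q s : Kˣ) (y y' : Oq q s) : actR q s (Uq.kinv q) (y * y') =
    actR q s (Uq.kinv q) y * actR q s (Uq.kinv q) y' := by
  ext1; simp [dualR_mul, Uq.comul_kinv]

lemma dualL_one_left (q : Kˣ) (f : Dual q) : dualL q 1 f = f := by ext; simp

lemma dualR_one_left (q : Kˣ) (f : Dual q) : dualR q 1 f = f := by ext; simp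

lemma actL_E_mul (q s : Kˣ) (y y' : Oq q s) : actL q s (Uq.E q) (y * y') =
    actL q s (Uq.E q) y * y' + actL q s (Uq.k q) y * actL q s (Uq.E q) y' := by
  ext1; simp [dualL_mul, Uq.comul_E, dualL_one_left]

lemma actR_E_mul (q s : Kˣ) (y y' : Oq q s) : actR q s (Uq.E q) (y * y') =
    actR q s (Uq.E q) y * y' + actR q s (Uq.k q) y * actR q s (Uq.E q) y' := by
  ext1; simp [dualR_mul, Uq.comul_E, dualR_one_left]

lemma actL_F_mul (q s : Kˣ) (y y' : Oq q s) : actL q s (Uq.F q) (y * y') =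
    actL q s (Uq.F q) y * actL q s (Uq.kinv q) y' + y * actL q s (Uq.F q) y' := by
  ext1; simp [dualL_mul, Uq.comul_F, dualL_one_left]

lemma actR_F_mul (q s : Kˣ) (y y' : Oq q s) : actR q s (Uq.F q) (y * y') =
    actR q s (Uq.F q) y * actR q s (Uq.kinv q) y' + y * actR q s (Uq.F q) y' := by
  ext1; simp [dualR_mul, Uq.comul_F, dualR_one_left]

/-! The rules that bring iterated actions of the generators into a normal form. -/

section normalForm

variable (q s : Kˣ) (y : Oq q s)

lemma actL_k_kinv : actL q s (Uq.k q) (actL q s (Uq.kinv q) y) = y := by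
  rw [← actL_mul_left, Uq.k_mul_kinv, actL_one_left]

lemma actL_kinv_k : actL q s (Uq.kinv q) (actL q s (Uq.k q) y) = y := by
  rw [← actL_mul_left, Uq.kinv_mul_k, actL_one_left]

lemma actR_k_kinv : actR q s (Uq.k q) (actR q s (Uq.kinv q) y) = y := by
  rw [← actR_mul_left, Uq.kinv_mul_k, actR_one_left]

lemma actR_kinv_k : actR q s (Uq.kinv q) (actR q s (Uq.k q) y) = y := by
  rw [← actR_mul_left, Uq.k_mul_kinv, actR_one_left]

lemma actL_k_E : actL q s (Uq.k q) (actL q s (Uq.E q) y) =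
    ((q : K) ^ 2) • actL q s (Uq.E q) (actL q s (Uq.k q) y) := by
  simp only [← actL_mul_left, Uq.k_mul_E, map_smul, LinearMap.smul_apply]

lemma actL_k_F : actL q s (Uq.k q) (actL q s (Uq.F q) y) =
    ((q : K)⁻¹ ^ 2) • actL q s (Uq.F q) (actL q s (Uq.k q) y) := by
  simp only [← actL_mul_left, Uq.k_mul_F, map_smul, LinearMap.smul_apply]

lemma actR_E_k : actR q s (Uq.E q) (actR q s (Uq.k q) y) =
    ((q : K) ^ 2) • actR q s (Uq.k q) (actR q s (Uq.E q) y) := by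
  simp only [← actR_mul_left, Uq.k_mul_E, map_smul, LinearMap.smul_apply]

lemma actR_E_kinv : actR q s (Uq.E q) (actR q s (Uq.kinv q) y) =
    ((q : K)⁻¹ ^ 2) • actR q s (Uq.kinv q) (actR q s (Uq.E q) y) := by
  simp only [← actR_mul_left, Uq.kinv_mul_E, map_smul, LinearMap.smul_apply]

lemma actR_F_k : actR q s (Uq.F q) (actR q s (Uq.k q) y) =
    ((q : K)⁻¹ ^ 2) • actR q s (Uq.k q) (actR q s (Uq.F q) y) := by
  simp only [← actR_mul_left, Uq.k_mul_F, map_smul, LinearMap.smul_apply]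

lemma actL_E_F {q : Kˣ} (hq : (q : K) - (q : K)⁻¹ ≠ 0) (s : Kˣ) (y : Oq q s) :
    actL q s (Uq.E q) (actL q s (Uq.F q) y) = actL q s (Uq.F q) (actL q s (Uq.E q) y) +
      ((q : K) - (q : K)⁻¹)⁻¹ • (actL q s (Uq.k q) y - actL q s (Uq.kinv q) y) := by
  rw [← LinearMap.sub_apply, ← map_sub, ← Uq.E_F]
  simp [smul_smul, hq, actL_mul_left]

lemma actR_F_E {q : Kˣ} (hq : (q : K) - (q : K)⁻¹ ≠ 0) (s : Kˣ) (y : Oq q s) :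
    actR q s (Uq.F q) (actR q s (Uq.E q) y) = actR q s (Uq.E q) (actR q s (Uq.F q) y) +
      ((q : K) - (q : K)⁻¹)⁻¹ • (actR q s (Uq.k q) y - actR q s (Uq.kinv q) y) := by
  rw [← LinearMap.sub_apply, ← map_sub, ← Uq.E_F]
  simp [smul_smul, hq, actR_mul_left]

end normalForm

/-! ### A representation of the Drinfeld double -/

/-- The coefficients of `F` in the representation of `U_q(sl₂)` on sequences in which `E` is the
backward shift and `k` multiplies the `j`-th term by `q^{-2j}`. -/
def fCoeff (q : Kˣ) (j : ℕ) : K :=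
  ∑ l ∈ Finset.range j, ((q : K) - (q : K)⁻¹)⁻¹ * (((q : K)⁻¹ ^ 2) ^ l - ((q : K) ^ 2) ^ l)

lemma fCoeff_succ (q : Kˣ) (j : ℕ) : fCoeff q (j + 1) = fCoeff q j +
    ((q : K) - (q : K)⁻¹)⁻¹ * (((q : K)⁻¹ ^ 2) ^ j - ((q : K) ^ 2) ^ j) :=
  Finset.sum_range_succ _ _

@[simp] lemma fCoeff_zero (q : Kˣ) : fCoeff q 0 = 0 := Finset.sum_range_zero _

/-- The operator of `k` on sequences in `O_q(SL(2))`. -/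
def repk (q s : Kˣ) : Module.End K (ℕ → Oq q s) :=
  LinearMap.pi fun j => (((q : K)⁻¹ ^ 2) ^ j) •
    (actL q s (Uq.k q) ∘ₗ actR q s (Uq.kinv q) ∘ₗ LinearMap.proj j)

/-- The operator of `k⁻¹` on sequences in `O_q(SL(2))`. -/
def repkinv (q s : Kˣ) : Module.End K (ℕ → Oq q s) :=
  LinearMap.pi fun j => (((q : K) ^ 2) ^ j) •
    (actL q s (Uq.kinv q) ∘ₗ actR q s (Uq.k q) ∘ₗ LinearMap.proj j)

/-- The operator of `E` on sequences in `O_q(SL(2))`. Its form is forced by the exchange relation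
`(E ▷ y) + (k ▷ y) E = E y + k (y ◁ E)`, with `E` and `k` acting on sequences of scalars as in
`fCoeff`. -/
def repE (q s : Kˣ) : Module.End K (ℕ → Oq q s) :=
  LinearMap.pi fun j => actL q s (Uq.E q) ∘ₗ LinearMap.proj j +
    actL q s (Uq.k q) ∘ₗ LinearMap.proj (j + 1) -
    (((q : K)⁻¹ ^ 2) ^ j) • (actL q s (Uq.k q) ∘ₗ actR q s (Uq.kinv q) ∘ₗ
      actR q s (Uq.E q) ∘ₗ LinearMap.proj j)

/-- The operator of `F` on sequences in `O_q(SL(2))`. Its form is forced by the exchange relation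
`(F ▷ y) k⁻¹ + y F = F (y ◁ k⁻¹) + y ◁ F`. At `j = 0` the truncated index `j - 1` is harmless, as
`fCoeff q 0 = 0`. -/
def repF (q s : Kˣ) : Module.End K (ℕ → Oq q s) :=
  LinearMap.pi fun j => (((q : K) ^ 2) ^ j) •
      (actL q s (Uq.F q) ∘ₗ actR q s (Uq.k q) ∘ₗ LinearMap.proj j) +
    fCoeff q j • (actR q s (Uq.k q) ∘ₗ LinearMap.proj (j - 1)) -
    actR q s (Uq.F q) ∘ₗ actR q s (Uq.k q) ∘ₗ LinearMap.proj j

section apply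

variable (q s : Kˣ) (g : ℕ → Oq q s) (j : ℕ)

lemma repk_apply : repk q s g j =
    (((q : K)⁻¹ ^ 2) ^ j) • actL q s (Uq.k q) (actR q s (Uq.kinv q) (g j)) := rfl

lemma repkinv_apply : repkinv q s g j =
    (((q : K) ^ 2) ^ j) • actL q s (Uq.kinv q) (actR q s (Uq.k q) (g j)) := rfl

lemma repE_apply : repE q s g j = actL q s (Uq.E q) (g j) + actL q s (Uq.k q) (g (j + 1)) -
    (((q : K)⁻¹ ^ 2) ^ j) •
      actL q s (Uq.k q) (actR q s (Uq.kinv q) (actR q s (Uq.E q) (g j))) := rfl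

lemma repF_apply : repF q s g j =
    (((q : K) ^ 2) ^ j) • actL q s (Uq.F q) (actR q s (Uq.k q) (g j)) +
    fCoeff q j • actR q s (Uq.k q) (g (j - 1)) -
    actR q s (Uq.F q) (actR q s (Uq.k q) (g j)) := rfl

end apply

lemma repk_mul_repkinv (q s : Kˣ) : repk q s * repkinv q s = 1 := by
  have hq0 : (q : K) ≠ 0 := q.ne_zero
  ext1 g; funext j
  simp only [Module.End.mul_apply, repk_apply, repkinv_apply, map_smul, actR_actL, actL_k_kinv,
    actR_kinv_k, smul_smul, Module.End.one_apply, ← mul_pow]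
  simp [hq0]

lemma repkinv_mul_repk (q s : Kˣ) : repkinv q s * repk q s = 1 := by
  have hq0 : (q : K) ≠ 0 := q.ne_zero
  ext1 g; funext j
  simp only [Module.End.mul_apply, repk_apply, repkinv_apply, map_smul, actR_actL, actL_kinv_k,
    actR_k_kinv, smul_smul, Module.End.one_apply, ← mul_pow]
  simp [hq0]

lemma repk_mul_repE (q s : Kˣ) : repk q s * repE q s = ((q : K) ^ 2) • (repE q s * repk q s) := by
  have hq0 : (q : K) ≠ 0 := q.ne_zero
  ext1 g; funext j
  simp only [Module.End.mul_apply, LinearMap.smul_apply, Pi.smul_apply, repk_apply, repE_apply,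
    map_smul, map_add, map_sub, actR_actL, actL_k_E, actR_E_kinv, pow_succ]
  match_scalars <;> field_simp

lemma repk_mul_repF (q s : Kˣ) :
    repk q s * repF q s = ((q : K)⁻¹ ^ 2) • (repF q s * repk q s) := by
  have hq0 : (q : K) ≠ 0 := q.ne_zero
  ext1 g; funext j
  obtain _ | j := j <;>
  simp only [Module.End.mul_apply, LinearMap.smul_apply, Pi.smul_apply, repk_apply, repF_apply,
    map_smul, map_add, map_sub, actR_actL, actL_k_F, actR_F_k, actR_k_kinv,
    actR_kinv_k, pow_succ, pow_zero, one_smul, add_zero,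
    add_tsub_cancel_right, fCoeff_zero, zero_smul, zero_tsub] <;>
  match_scalars <;> field_simp

lemma repE_repF {q : Kˣ} (hq : (q : K) - (q : K)⁻¹ ≠ 0) (s : Kˣ) :
    ((q : K) - (q : K)⁻¹) • (repE q s * repF q s - repF q s * repE q s) =
      repk q s - repkinv q s := by
  have hq0 : (q : K) ≠ 0 := q.ne_zero
  have hq2 : (q : K) ^ 2 - 1 ≠ 0 := by
    contrapose! hq
    field_simp
    linear_combination hq
  ext1 g; funext j
  obtain _ | j := j <;>
  simp only [Module.End.mul_apply, LinearMap.smul_apply, Pi.smul_apply, LinearMap.sub_apply,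
    Pi.sub_apply, repk_apply, repF_apply, repE_apply, repkinv_apply,
    map_smul, map_add, map_sub, actR_actL, actL_k_F, actL_E_F hq, actR_F_k,
    actR_k_kinv, actR_F_E hq, actR_E_k, zero_add,
    actR_kinv_k, fCoeff_succ, pow_succ, pow_zero, one_smul, add_zero,
    add_tsub_cancel_right, fCoeff_zero, zero_smul,
    zero_tsub] <;>
  match_scalars <;> field_simp <;> ring

/-- The action of `U_q(sl₂)` on sequences in `O_q(SL(2))`. -/
def repU {q : Kˣ} (hq : (q : K) - (q : K)⁻¹ ≠ 0) (s : Kˣ) :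
    Uq q →ₐ[K] Module.End K (ℕ → Oq q s) :=
  Uq.lift q (repE q s) (repF q s) (repk q s) (repkinv q s) (repk_mul_repkinv q s)
    (repkinv_mul_repk q s) (repk_mul_repE q s) (repk_mul_repF q s) (repE_repF hq s)

/-- The action of `O_q(SL(2))` on sequences in `O_q(SL(2))` by termwise multiplication. -/
def repO (q s : Kˣ) : Oq q s →ₐ[K] Module.End K (ℕ → Oq q s) where
  toFun y := LinearMap.pi fun j => LinearMap.mulLeft K y ∘ₗ LinearMap.proj j
  map_one' := by ext1 g; funext j; simp
  map_mul' y y' := by ext1 g; funext j; simp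
  map_zero' := by ext1 g; funext j; simp
  map_add' y y' := by ext1 g; funext j; simp [add_mul]
  commutes' r := by ext1 g; funext j; simp [Algebra.smul_def]

lemma repO_apply (q s : Kˣ) (y : Oq q s) (g : ℕ → Oq q s) (j : ℕ) :
    repO q s y g j = y * g j := rfl

/-- The exchange relation for `x` and all `y`, in an algebra `A` to which `U_q(sl₂)` and
`O_q(SL(2))` are mapped. -/
def Exchange {q s : Kˣ} {A : Type*} [Ring A] [Algebra K A] (α : Uq q →ₐ[K] A)
    (β : Oq q s →ₐ[K] A) (x : Uq q) : Prop :=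
  ∀ y : Oq q s,
    LinearMap.mul' K A (TensorProduct.map (β.toLinearMap ∘ₗ (actL q s).flip y) α.toLinearMap
        (Coalgebra.comul (R := K) x)) =
      LinearMap.mul' K A (TensorProduct.map α.toLinearMap (β.toLinearMap ∘ₗ (actR q s).flip y)
        (Coalgebra.comul (R := K) x))

lemma exchange_iff {q s : Kˣ} {A : Type*} [Ring A] [Algebra K A] (α : Uq q →ₐ[K] A)
    (β : Oq q s →ₐ[K] A) {x : Uq q} {ι : Type*} (t : Finset ι) (l r : ι → Uq q)
    (h : Coalgebra.comul (R := K) x = ∑ i ∈ t, l i ⊗ₜ r i) :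
    Exchange α β x ↔ ∀ y : Oq q s, ∑ i ∈ t, β (actL q s (l i) y) * α (r i) =
      ∑ i ∈ t, α (l i) * β (actR q s (r i) y) := by
  simp [Exchange, h]

/-- The elements that satisfy the exchange relation are closed under multiplication. -/
lemma Exchange.mul {q s : Kˣ} {A : Type*} [Ring A] [Algebra K A] {α : Uq q →ₐ[K] A}
    {β : Oq q s →ₐ[K] A} {x x' : Uq q} (h : Exchange α β x) (h' : Exchange α β x') :
    Exchange α β (x * x') := by
  obtain ⟨t, hx⟩ := TensorProduct.exists_finset (Coalgebra.comul (R := K) x)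
  obtain ⟨t', hx'⟩ := TensorProduct.exists_finset (Coalgebra.comul (R := K) x')
  rw [exchange_iff α β t Prod.fst Prod.snd hx] at h
  rw [exchange_iff α β t' Prod.fst Prod.snd hx'] at h'
  have hxx : Coalgebra.comul (R := K) (x * x') =
      ∑ p ∈ t ×ˢ t', (p.1.1 * p.2.1) ⊗ₜ[K] (p.1.2 * p.2.2) := by
    rw [Bialgebra.comul_mul, hx, hx', Finset.sum_mul_sum, Finset.sum_product]
    simp only [Algebra.TensorProduct.tmul_mul_tmul]
  rw [exchange_iff α β (t ×ˢ t') _ _ hxx]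
  intro y
  simp only [Finset.sum_product, actL_mul_left, actR_mul_left, map_mul]
  calc _ = ∑ b ∈ t', (∑ a ∈ t, β (actL q s a.1 (actL q s b.1 y)) * α a.2) * α b.2 := by
        rw [Finset.sum_comm]
        simp only [Finset.sum_mul, mul_assoc]
    _ = ∑ a ∈ t, α a.1 * ∑ b ∈ t', β (actL q s b.1 (actR q s a.2 y)) * α b.2 := by
        simp only [h, Finset.sum_mul, Finset.mul_sum, mul_assoc, actR_actL]
        rw [Finset.sum_comm]
    _ = _ := by simp only [h', Finset.mul_sum, mul_assoc]

lemma exchange_of_gen {q s : Kˣ} {A : Type*} [Ring A] [Algebra K A] {α : Uq q →ₐ[K] A}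
    {β : Oq q s →ₐ[K] A} (hE : Exchange α β (Uq.E q))
    (hF : Exchange α β (Uq.F q)) (hk : Exchange α β (Uq.k q)) (hk' : Exchange α β (Uq.kinv q))
    (x : Uq q) : Exchange α β x := by
  induction x using Uq.induction_on with
  | hc r =>
    intro y
    simp [Algebra.algebraMap_eq_smul_one, Algebra.TensorProduct.one_def, actL_one_left,
      actR_one_left]
  | hE => exact hE
  | hF => exact hF
  | hk => exact hk
  | hk' => exact hk'
  | ha x x' hx hx' => intro y; simp only [map_add, hx y, hx' y]
  | hm x x' hx hx' => exact hx.mul hx'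

lemma exchange_rep {q : Kˣ} (hq : (q : K) - (q : K)⁻¹ ≠ 0) (s : Kˣ) (x : Uq q) :
    Exchange (repU hq s) (repO q s) x := by
  have hq0 : (q : K) ≠ 0 := q.ne_zero
  have hE : repU hq s (Uq.E q) = repE q s := Uq.lift_E ..
  have hF : repU hq s (Uq.F q) = repF q s := Uq.lift_F ..
  have hk : repU hq s (Uq.k q) = repk q s := Uq.lift_k ..
  have hk' : repU hq s (Uq.kinv q) = repkinv q s := Uq.lift_kinv ..
  refine exchange_of_gen (fun y => ?_) (fun y => ?_) (fun y => ?_) (fun y => ?_) x <;>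
    ext1 w <;> funext j
  · simp only [Uq.comul_E, map_add, TensorProduct.map_tmul, LinearMap.mul'_apply,
      LinearMap.comp_apply,
      LinearMap.flip_apply, AlgHom.toLinearMap_apply, hE, hk, map_one, mul_one, LinearMap.add_apply,
      Pi.add_apply, Module.End.mul_apply, repO_apply, repE_apply, repk_apply, actL_E_mul,
      actL_k_mul, actR_E_mul, actR_kinv_mul, map_add, mul_add, mul_sub, actR_kinv_k, actR_one_left,
      smul_add, mul_smul_comm]
    abel
  · simp only [Uq.comul_F, map_add, TensorProduct.map_tmul, LinearMap.mul'_apply,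
      LinearMap.comp_apply,
      LinearMap.flip_apply, AlgHom.toLinearMap_apply, hF, hk', map_one, one_mul,
      LinearMap.add_apply, actL_one_left,
      Pi.add_apply, Module.End.mul_apply, repO_apply, repF_apply, repkinv_apply, actL_F_mul,
      actR_k_mul, actR_F_mul, map_add, mul_add, mul_sub, actR_kinv_k,
      smul_add, mul_smul_comm, actR_k_kinv]
    abel
  · simp only [Uq.comul_k, TensorProduct.map_tmul, LinearMap.mul'_apply, LinearMap.comp_apply,
      LinearMap.flip_apply, AlgHom.toLinearMap_apply, hk, Module.End.mul_apply, repO_apply,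
      repk_apply, actL_k_mul, actR_kinv_mul, actR_kinv_k, mul_smul_comm]
  · simp only [Uq.comul_kinv, TensorProduct.map_tmul, LinearMap.mul'_apply, LinearMap.comp_apply,
      LinearMap.flip_apply, AlgHom.toLinearMap_apply, hk', Module.End.mul_apply, repO_apply,
      repkinv_apply, actL_kinv_mul, actR_k_mul, actR_k_kinv, mul_smul_comm]

/-- The representation of the Drinfeld double on sequences in `O_q(SL(2))`: it is induced from the
representation of `U_q(sl₂)` on sequences of scalars in which `E` is the backward shift and `k`
multiplies the `j`-th term by `q^{-2j}`. -/
def repD {q : Kˣ} (hq : (q : K) - (q : K)⁻¹ ≠ 0) (s : Kˣ) :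
    Double q s →ₐ[K] Module.End K (ℕ → Oq q s) :=
  RingQuot.liftAlgHom K ⟨TensorAlgebra.lift K
      (LinearMap.coprod (repU hq s).toLinearMap (repO q s).toLinearMap), by
    set φ := TensorAlgebra.lift K
      (LinearMap.coprod (repU hq s).toLinearMap (repO q s).toLinearMap) with hφ
    have hU : ∀ x, φ (preU q s x) = repU hq s x := fun x => by simp [hφ, preU]
    have hO : ∀ y, φ (preO q s y) = repO q s y := fun y => by simp [hφ, preO]
    rintro _ _ (_ | ⟨x, x'⟩ | _ | ⟨y, y'⟩ | ⟨x, y⟩)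
    · simp [hU]
    · simp [hU]
    · simp [hO]
    · simp [hO]
    · obtain ⟨t, hx⟩ := TensorProduct.exists_finset (Coalgebra.comul (R := K) x)
      have := (exchange_iff (repU hq s) (repO q s) t Prod.fst Prod.snd hx).1 (exchange_rep hq s x) y
      simpa [hx, hU, hO] using this⟩

lemma repD_ofU {q : Kˣ} (hq : (q : K) - (q : K)⁻¹ ≠ 0) (s : Kˣ) (x : Uq q) :
    repD hq s (Double.ofU q s x) = repU hq s x := by
  refine (RingQuot.liftAlgHom_mkAlgHom_apply K _ _ _).trans ?_
  simp [preU]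

lemma repD_ofO {q : Kˣ} (hq : (q : K) - (q : K)⁻¹ ≠ 0) (s : Kˣ) (y : Oq q s) :
    repD hq s (Double.ofO q s y) = repO q s y := by
  refine (RingQuot.liftAlgHom_mkAlgHom_apply K _ _ _).trans ?_
  simp [preO]

section theta

variable [Algebra ℂ K]

lemma im_mul_im : im K * im K = -1 := by
  rw [im, ← map_mul, Complex.I_mul_I, map_neg, map_one]

lemma im_ne_zero : im K ≠ 0 := fun h => by
  have := im_mul_im (K := K)
  simp [h] at this

/-- The lowest term of `θⁿ` applied to the `N`-th standard sequence has index `N - n`, because `E`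
shifts backwards while `F k` shifts forwards. -/
lemma repU_theta_pow_single {q : Kˣ} (hq : (q : K) - (q : K)⁻¹ ≠ 0) (s : Kˣ) (N n : ℕ) :
    ∃ v : ℕ → K, (repU hq s (theta q s) ^ n) (Pi.single N 1) = (fun j => v j • (1 : Oq q s)) ∧
      (∀ j, j + n < N → v j = 0) ∧ ∀ j, j + n = N → v j = (im K * (s : K)⁻¹) ^ n := by
  have hE : repU hq s (Uq.E q) = repE q s := Uq.lift_E ..
  have hF : repU hq s (Uq.F q) = repF q s := Uq.lift_F ..
  have hk : repU hq s (Uq.k q) = repk q s := Uq.lift_k ..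
  induction n with
  | zero =>
    refine ⟨Pi.single N 1, ?_, fun j hj => ?_, fun j hj => ?_⟩
    · funext j
      by_cases h : j = N <;> simp [h]
    · simp [(show j ≠ N by omega)]
    · simp [(show j = N by omega)]
  | succ n ih =>
    obtain ⟨v, hv, h0, h1⟩ := ih
    refine ⟨fun j => im K * (s : K)⁻¹ *
      (v (j + 1) - fCoeff q j * ((q : K)⁻¹ ^ 2) ^ (j - 1) * v (j - 1)), ?_, fun j hj => ?_,
      fun j hj => ?_⟩
    · rw [pow_succ', Module.End.mul_apply, hv, theta, map_smul, map_sub, map_mul, hE, hF, hk]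
      funext j
      simp [repE_apply, repF_apply, repk_apply, smul_smul]
      module
    · simp only [h0 (j + 1) (by omega), h0 (j - 1) (by omega), mul_zero, sub_zero]
    · simp only [h1 (j + 1) (by omega), h0 (j - 1) (by omega), mul_zero, sub_zero]
      ring

end theta

/-! ### Values on the lower triangular part of `U_q(sl₂)` -/

/-- The value of a linear form on `U_q(sl₂)` at the element `F^i k^j`, where `j` may be negative. -/
def pair {q : Kˣ} (f : Dual q) (i : ℕ) (j : ℤ) : K :=
  Dual.eval q f (Uq.F q ^ i * ((Uq.kUnit q ^ j : (Uq q)ˣ) : Uq q))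

/-- The number `1 + q² + ⋯ + q^{2(n-1)}`. -/
def qNum (q : Kˣ) (n : ℕ) : K := ∑ l ∈ Finset.range n, ((q : K) ^ 2) ^ l

lemma qNum_zero (q : Kˣ) : qNum q 0 = 0 := Finset.sum_range_zero _

lemma qNum_succ (q : Kˣ) (n : ℕ) : qNum q (n + 1) = qNum q n + ((q : K) ^ 2) ^ n :=
  Finset.sum_range_succ _ _

lemma qNum_succ' (q : Kˣ) (n : ℕ) : qNum q (n + 1) = (q : K) ^ 2 * qNum q n + 1 := by
  rw [qNum, Finset.sum_range_succ', qNum, Finset.mul_sum]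
  simp [pow_succ']

lemma qNum_ne_zero {q : Kˣ} (hq : ∀ n : ℕ, 0 < n → q ^ n ≠ 1) (n : ℕ) : qNum q (n + 1) ≠ 0 := by
  intro h
  have := geom_sum_mul ((q : K) ^ 2) (n + 1)
  rw [← qNum, h, zero_mul, ← pow_mul, eq_comm, sub_eq_zero] at this
  exact q_pow_ne_one hq (by positivity) this

lemma Uq.kUnit_zpow_mul {q : Kˣ} {x : Uq q} {c : Kˣ} (h : k q * x = (c : K) • (x * k q)) (j : ℤ) :
    ((kUnit q ^ j : (Uq q)ˣ) : Uq q) * x =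
      ((c ^ j : Kˣ) : K) • (x * ((kUnit q ^ j : (Uq q)ˣ) : Uq q)) := by
  have h' : kinv q * x = ((c⁻¹ : Kˣ) : K) • (x * kinv q) := by
    have h2 : kinv q * (k q * x) * kinv q = kinv q * ((c : K) • (x * k q)) * kinv q := by rw [h]
    rw [← mul_assoc, kinv_mul_k, one_mul, mul_smul_comm, smul_mul_assoc, mul_assoc, mul_assoc,
      k_mul_kinv, mul_one] at h2
    rw [h2, smul_smul]
    simp
  induction j with
  | zero => simp
  | succ n ih =>
    rw [zpow_add_one, zpow_add_one, Units.val_mul, coe_kUnit, mul_assoc, h, mul_smul_comm,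
      ← mul_assoc, ih, smul_mul_assoc, smul_smul, mul_assoc, Units.val_mul, mul_comm (c : K)]
  | pred n ih =>
    rw [zpow_sub_one, zpow_sub_one, Units.val_mul, coe_kUnit_inv, mul_assoc, h', mul_smul_comm,
      ← mul_assoc, ih, smul_mul_assoc, smul_smul, mul_assoc, Units.val_mul,
      mul_comm ((c⁻¹ : Kˣ) : K)]

lemma Uq.kUnit_zpow_mul_E (q : Kˣ) (j : ℤ) : ((kUnit q ^ j : (Uq q)ˣ) : Uq q) * E q =
    (((q ^ 2) ^ j : Kˣ) : K) • (E q * ((kUnit q ^ j : (Uq q)ˣ) : Uq q)) :=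
  kUnit_zpow_mul (by simpa using k_mul_E q) j

lemma Uq.kUnit_zpow_mul_F (q : Kˣ) (j : ℤ) : ((kUnit q ^ j : (Uq q)ˣ) : Uq q) * F q =
    (((q⁻¹ ^ 2) ^ j : Kˣ) : K) • (F q * ((kUnit q ^ j : (Uq q)ˣ) : Uq q)) :=
  kUnit_zpow_mul (by simpa using k_mul_F q) j

lemma Uq.kinv_mul_F_pow (q : Kˣ) (i : ℕ) :
    kinv q * F q ^ i = (((q : K) ^ 2) ^ i) • (F q ^ i * kinv q) := by
  induction i with
  | zero => simp
  | succ i ih =>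
    rw [pow_succ, ← mul_assoc, ih, smul_mul_assoc, mul_assoc, kinv_mul_F, mul_smul_comm, smul_smul,
      ← mul_assoc, pow_succ ((q : K) ^ 2)]

section pair

variable {q : Kˣ}

@[simp] lemma pair_add (f g : Dual q) (i : ℕ) (j : ℤ) :
    pair (f + g) i j = pair f i j + pair g i j := by simp [pair]

@[simp] lemma pair_sub (f g : Dual q) (i : ℕ) (j : ℤ) :
    pair (f - g) i j = pair f i j - pair g i j := by simp [pair]

@[simp] lemma pair_smul (c : K) (f : Dual q) (i : ℕ) (j : ℤ) :
    pair (c • f) i j = c * pair f i j := by simp [pair]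

@[simp] lemma pair_zero (i : ℕ) (j : ℤ) : pair (0 : Dual q) i j = 0 := by simp [pair]

lemma pair_dualR_F (f : Dual q) (i : ℕ) (j : ℤ) :
    pair (dualR q (Uq.F q) f) i j = pair f (i + 1) j := by
  simp [pair, pow_succ', mul_assoc]

lemma pair_dualR_kinv (f : Dual q) (i : ℕ) (j : ℤ) :
    pair (dualR q (Uq.kinv q) f) i j = ((q : K) ^ 2) ^ i * pair f i (j - 1) := by
  have h : ((Uq.kUnit q ^ (j - 1) : (Uq q)ˣ) : Uq q) =
      Uq.kinv q * ((Uq.kUnit q ^ j : (Uq q)ˣ) : Uq q) := by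
    rw [zpow_sub_one, ((Commute.refl (Uq.kUnit q)).inv_right.zpow_left j).eq, Units.val_mul,
      Uq.coe_kUnit_inv]
  rw [pair, eval_dualR, ← mul_assoc, Uq.kinv_mul_F_pow, smul_mul_assoc, map_smul, smul_eq_mul,
    pair, h, mul_assoc]

lemma pair_dualL_k (f : Dual q) (i : ℕ) (j : ℤ) :
    pair (dualL q (Uq.k q) f) i j = pair f i (j + 1) := by
  simp [pair, zpow_add_one, mul_assoc]

lemma pair_dualL_kinv (f : Dual q) (i : ℕ) (j : ℤ) :
    pair (dualL q (Uq.kinv q) f) i j = pair f i (j - 1) := by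
  simp [pair, zpow_sub_one, mul_assoc, Uq.coe_kUnit_inv]

lemma pair_mul_zero (f g : Dual q) (j : ℤ) : pair (f * g) 0 j = pair f 0 j * pair g 0 j := by
  induction j generalizing f g with
  | zero => simp [pair, Dual.eval_mul, Algebra.TensorProduct.one_def]
  | succ n ih =>
    simp only [← pair_dualL_k, ← ih]
    simp [dualL_mul, Uq.comul_k]
  | pred n ih =>
    simp only [← pair_dualL_kinv, ← ih]
    simp [dualL_mul, Uq.comul_kinv]

/-- The coproduct `Δ(F) = F ⊗ k⁻¹ + 1 ⊗ F` reduces the values of a product to smaller `i`. -/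
lemma pair_mul_succ (f g : Dual q) (i : ℕ) (j : ℤ) : pair (f * g) (i + 1) j =
    pair (dualR q (Uq.F q) f * dualR q (Uq.kinv q) g) i j + pair (f * dualR q (Uq.F q) g) i j := by
  rw [← pair_dualR_F, ← pair_add]
  simp [dualR_mul, Uq.comul_F, dualR_one_left]

lemma pair_mul_eq_zero_left {f : Dual q} (hf : ∀ i j, pair f i j = 0) (g : Dual q) (i : ℕ)
    (j : ℤ) : pair (f * g) i j = 0 := by
  induction i generalizing f g with
  | zero => rw [pair_mul_zero, hf, zero_mul]
  | succ i ih => rw [pair_mul_succ, ih (by simp [pair_dualR_F, hf]), ih hf, add_zero]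

lemma pair_mul_eq_zero_right {f : Dual q} (hf : ∀ i j, pair f i j = 0) (g : Dual q) (i : ℕ)
    (j : ℤ) : pair (g * f) i j = 0 := by
  induction i generalizing f g with
  | zero => rw [pair_mul_zero, hf, mul_zero]
  | succ i ih =>
    rw [pair_mul_succ, ih (by simp [pair_dualR_kinv, hf]), ih (by simp [pair_dualR_F, hf]),
      add_zero]

lemma pair_mul_of_degree_zero_left {f : Dual q} (hf : ∀ i j, pair f (i + 1) j = 0) (g : Dual q)
    (i : ℕ) (j : ℤ) : pair (f * g) i j = pair f 0 j * pair g i j := by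
  induction i generalizing g with
  | zero => rw [pair_mul_zero]
  | succ i ih =>
    rw [pair_mul_succ, pair_mul_eq_zero_left (by simp [pair_dualR_F, hf]), ih, pair_dualR_F,
      zero_add]

lemma pair_mul_of_degree_zero_right {f : Dual q} (hf : ∀ i j, pair f (i + 1) j = 0) (g : Dual q)
    (i : ℕ) (j : ℤ) : pair (g * f) i j = pair g i j * pair f 0 (j - i) := by
  induction i generalizing f g with
  | zero => simp [pair_mul_zero]
  | succ i ih =>
    rw [pair_mul_succ,
      pair_mul_eq_zero_right (f := dualR q (Uq.F q) f) (by simp [pair_dualR_F, hf]),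
      ih (by simp [pair_dualR_kinv, hf]), pair_dualR_F, pair_dualR_kinv, add_zero, pow_zero,
      one_mul]
    congr 2
    push_cast
    ring

lemma pair_mul_of_degree_one_left {f : Dual q} (h0 : ∀ j, pair f 0 j = 0)
    (h2 : ∀ i j, pair f (i + 2) j = 0) (g : Dual q) (i : ℕ) (j : ℤ) :
    pair (f * g) (i + 1) j = qNum q (i + 1) * pair f 1 j * pair g i (j - 1) := by
  induction i generalizing g with
  | zero =>
    rw [pair_mul_succ, pair_mul_zero, pair_mul_zero, h0, pair_dualR_F, pair_dualR_kinv, qNum_succ,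
      qNum_zero]
    ring
  | succ i ih =>
    rw [pair_mul_succ, pair_mul_of_degree_zero_left (by simp [pair_dualR_F, h2]), ih,
      pair_dualR_F, pair_dualR_F, pair_dualR_kinv, qNum_succ q (i + 1)]
    ring

lemma pair_mul_of_degree_one_right {f : Dual q} {c : K} (h0 : ∀ j, pair f 0 j = 0)
    (h1 : ∀ j, pair f 1 j = c) (h2 : ∀ i j, pair f (i + 2) j = 0) (g : Dual q) (i : ℕ) (j : ℤ) :
    pair (g * f) (i + 1) j = qNum q (i + 1) * c * pair g i j := by
  induction i generalizing f c g with
  | zero =>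
    rw [pair_mul_succ, pair_mul_zero, pair_mul_zero, pair_dualR_kinv, h0, pair_dualR_F,
      pair_dualR_F, h1, qNum_succ, qNum_zero]
    ring
  | succ i ih =>
    rw [pair_mul_succ, pair_mul_of_degree_zero_right (f := dualR q (Uq.F q) f)
      (by simp [pair_dualR_F, h2]),
      ih (f := dualR q (Uq.kinv q) f) (c := (q : K) ^ 2 * c) (by simp [pair_dualR_kinv, h0])
        (by simp [pair_dualR_kinv, h1]) (by simp [pair_dualR_kinv, h2]),
      pair_dualR_F, pair_dualR_F, h1, qNum_succ' q (i + 1)]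
    ring

end pair

section theta

variable [Algebra ℂ K]

/-- Since `U_q(sl₂)` is the sum of `θ U_q(sl₂)` and the span of the elements `F^i k^j`, an element
of `O_q(K\U)` is determined by its values at these. -/
lemma eq_zero_of_pair_eq_zero {q s : Kˣ} (hq : (q : K) - (q : K)⁻¹ ≠ 0) {y : Oq q s}
    (hy : y ∈ OqKU q s) (h : ∀ i j, pair (y : Dual q) i j = 0) : y = 0 := by
  set S : Submodule K (Uq q) := LinearMap.range (LinearMap.mulLeft K (theta q s)) ⊔
    Submodule.span K (Set.range fun p : ℕ × ℤ =>
      Uq.F q ^ p.1 * ((Uq.kUnit q ^ p.2 : (Uq q)ˣ) : Uq q)) with hS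
  have hθ : ∀ w, theta q s * w ∈ S := fun w =>
    Submodule.mem_sup_left ⟨w, rfl⟩
  have hFk : ∀ (i : ℕ) (j : ℤ), Uq.F q ^ i * ((Uq.kUnit q ^ j : (Uq q)ˣ) : Uq q) ∈ S := fun i j =>
    Submodule.mem_sup_right (Submodule.subset_span ⟨(i, j), rfl⟩)
  have hmul : ∀ x, (∀ (i : ℕ) (j : ℤ), Uq.F q ^ i * ((Uq.kUnit q ^ j : (Uq q)ˣ) : Uq q) * x ∈ S) →
      ∀ m ∈ S, m * x ∈ S := by
    intro x hx
    change S ≤ S.comap (LinearMap.mulRight K x)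
    refine sup_le ?_ (Submodule.span_le.2 ?_)
    · rintro _ ⟨w, rfl⟩
      simpa [mul_assoc] using hθ (w * x)
    · rintro _ ⟨p, rfl⟩
      exact hx p.1 p.2
  have hk : ∀ (l : ℤ), ∀ m ∈ S, m * ((Uq.kUnit q ^ l : (Uq q)ˣ) : Uq q) ∈ S := fun l =>
    hmul _ fun i j => by
      rw [mul_assoc, ← Units.val_mul, ← zpow_add]
      exact hFk _ _
  have hF : ∀ m ∈ S, m * Uq.F q ∈ S := hmul _ fun i j => by
    rw [mul_assoc, Uq.kUnit_zpow_mul_F, mul_smul_comm, ← mul_assoc, ← pow_succ]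
    exact S.smul_mem _ (hFk _ _)
  -- modulo `θ U_q(sl₂)`, the generator `E` is `F k`, and `E` can be moved through `F` from right
  -- to left
  have hFE : ∀ i, Uq.F q ^ i * Uq.E q ∈ S := by
    intro i
    induction i with
    | zero =>
      have hc : im K * (s : K)⁻¹ ≠ 0 := mul_ne_zero im_ne_zero (inv_ne_zero s.ne_zero)
      have : Uq.E q = theta q s * algebraMap K _ (im K * (s : K)⁻¹)⁻¹ +
          Uq.F q ^ 1 * ((Uq.kUnit q ^ (1 : ℤ) : (Uq q)ˣ) : Uq q) := by
        rw [← Algebra.commutes, ← Algebra.smul_def, theta, smul_smul, inv_mul_cancel₀ hc]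
        simp
      rw [pow_zero, one_mul, this]
      exact S.add_mem (hθ _) (hFk _ _)
    | succ i ih =>
      have : Uq.F q ^ (i + 1) * Uq.E q = Uq.F q ^ i * Uq.E q * Uq.F q -
          ((q : K) - (q : K)⁻¹)⁻¹ • (Uq.F q ^ i * ((Uq.kUnit q ^ (1 : ℤ) : (Uq q)ˣ) : Uq q) -
            Uq.F q ^ i * ((Uq.kUnit q ^ (-1 : ℤ) : (Uq q)ˣ) : Uq q)) := by
        rw [zpow_one, zpow_neg_one, ← mul_sub, Uq.coe_kUnit, Uq.coe_kUnit_inv, ← Uq.E_F,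
          mul_smul_comm, smul_smul, inv_mul_cancel₀ hq, one_smul, mul_sub, pow_succ]
        simp only [mul_assoc]
        abel
      rw [this]
      exact S.sub_mem (hF _ ih) (S.smul_mem _ (S.sub_mem (hFk _ _) (hFk _ _)))
  have hE : ∀ m ∈ S, m * Uq.E q ∈ S := hmul _ fun i j => by
    rw [mul_assoc, Uq.kUnit_zpow_mul_E, mul_smul_comm, ← mul_assoc]
    exact S.smul_mem _ (hk _ _ (hFE i))
  have htop : ∀ x : Uq q, ∀ m ∈ S, m * x ∈ S := by
    intro x
    induction x using Uq.induction_on with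
    | hc r =>
      intro m hm
      rw [← Algebra.commutes, ← Algebra.smul_def]
      exact S.smul_mem _ hm
    | hE => exact hE
    | hF => exact hF
    | hk => simpa using hk 1
    | hk' => simpa [Uq.coe_kUnit_inv] using hk (-1)
    | ha x x' hx hx' =>
      intro m hm
      rw [mul_add]
      exact S.add_mem (hx m hm) (hx' m hm)
    | hm x x' hx hx' =>
      intro m hm
      rw [← mul_assoc]
      exact hx' _ (hx m hm)
  have hker : S ≤ LinearMap.ker (Dual.eval q (y : Dual q)) := by
    refine sup_le ?_ (Submodule.span_le.2 ?_)
    · rintro _ ⟨w, rfl⟩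
      have : actR q s (theta q s) y = 0 := hy
      have := congr_arg (fun z : Oq q s => Dual.eval q (z : Dual q) w) this
      simpa using this
    · rintro _ ⟨p, rfl⟩
      exact h p.1 p.2
  ext x
  have h1 : (1 : Uq q) ∈ S := by simpa using hFk 0 0
  simpa using hker (by simpa using htop x 1 h1)

end theta

/-! ### The elements `X`, `Y`, `Z` -/

lemma pair_of_dualL_k {q c : Kˣ} {f : Dual q} (h : dualL q (Uq.k q) f = (c : K) • f) (i : ℕ)
    (j : ℤ) : pair f i j = ((c ^ j : Kˣ) : K) * pair f i 0 := by
  have h1 : ∀ j, pair f i (j + 1) = c * pair f i j := fun j => by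
    rw [← pair_dualL_k, h, pair_smul]
  induction j with
  | zero => simp
  | succ n ih => rw [h1, ih, zpow_add_one, Units.val_mul]; ring
  | pred n ih =>
    have h2 := h1 (-(n : ℤ) - 1)
    rw [sub_add_cancel, ih] at h2
    rw [zpow_sub_one, Units.val_mul, Units.val_inv_eq_inv_val]
    have hc : (c : K) ≠ 0 := c.ne_zero
    field_simp
    rw [h2, mul_comm]

section coeff

variable (q s : Kˣ)

lemma actL_k_u_zero (i : Fin 2) : actL q s (Uq.k q) (uMat q s i 0) = (q : K) • uMat q s i 0 := by
  ext1
  simp [uMat, dualL_coeff, vecRep]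

lemma actL_k_u_one (i : Fin 2) : actL q s (Uq.k q) (uMat q s i 1) = (q : K)⁻¹ • uMat q s i 1 := by
  ext1
  simp [uMat, dualL_coeff, vecRep]

lemma dualR_F_u_zero (j : Fin 2) : dualR q (Uq.F q) (uMat q s 0 j : Dual q) = 0 := by
  simp [uMat, dualR_coeff, vecRep]

lemma dualR_F_u_one (j : Fin 2) : dualR q (Uq.F q) (uMat q s 1 j : Dual q) =
    (s : K)⁻¹ • (uMat q s 0 j : Dual q) := by
  simp [uMat, dualR_coeff, vecRep]

lemma pair_u_at_one (i j : Fin 2) : pair (uMat q s i j : Dual q) 0 0 = if i = j then 1 else 0 := by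
  simp [pair, uMat, Matrix.one_apply]

lemma pair_u_succ_zero (j : Fin 2) (m : ℕ) (n : ℤ) :
    pair (uMat q s 0 j : Dual q) (m + 1) n = 0 := by
  rw [← pair_dualR_F, dualR_F_u_zero, pair_zero]

lemma pair_u_succ_one (j : Fin 2) (m : ℕ) (n : ℤ) :
    pair (uMat q s 1 j : Dual q) (m + 1) n = (s : K)⁻¹ * pair (uMat q s 0 j : Dual q) m n := by
  rw [← pair_dualR_F, dualR_F_u_one, pair_smul]

lemma pair_u_col_zero (i : Fin 2) (m : ℕ) (n : ℤ) : pair (uMat q s i 0 : Dual q) m n =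
    ((q ^ n : Kˣ) : K) * pair (uMat q s i 0 : Dual q) m 0 :=
  pair_of_dualL_k (congr_arg Subtype.val (actL_k_u_zero q s i)) m n

lemma pair_u_col_one (i : Fin 2) (m : ℕ) (n : ℤ) : pair (uMat q s i 1 : Dual q) m n =
    ((q⁻¹ ^ n : Kˣ) : K) * pair (uMat q s i 1 : Dual q) m 0 :=
  pair_of_dualL_k (by simpa using congr_arg Subtype.val (actL_k_u_one q s i)) m n

/-! The entries of the matrix `u` are denoted by `a`, `b`, `c`, `d` in the names below. -/

lemma pair_b (m : ℕ) (n : ℤ) : pair (uMat q s 0 1 : Dual q) m n = 0 := by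
  obtain _ | m := m
  · simp [pair_u_col_one, pair_u_at_one]
  · exact pair_u_succ_zero q s 1 m n

lemma pair_d_succ (m : ℕ) (n : ℤ) : pair (uMat q s 1 1 : Dual q) (m + 1) n = 0 := by
  rw [pair_u_succ_one, pair_b, mul_zero]

lemma pair_d_zero (n : ℤ) : pair (uMat q s 1 1 : Dual q) 0 n = ((q⁻¹ ^ n : Kˣ) : K) := by
  rw [pair_u_col_one, pair_u_at_one, if_pos rfl, mul_one]

lemma pair_c_zero (n : ℤ) : pair (uMat q s 1 0 : Dual q) 0 n = 0 := by
  simp [pair_u_col_zero, pair_u_at_one]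

lemma pair_c_one (n : ℤ) :
    pair (uMat q s 1 0 : Dual q) 1 n = (s : K)⁻¹ * ((q ^ n : Kˣ) : K) := by
  rw [pair_u_succ_one, pair_u_col_zero, pair_u_at_one, if_pos rfl, mul_one]

lemma pair_c_add_two (m : ℕ) (n : ℤ) : pair (uMat q s 1 0 : Dual q) (m + 2) n = 0 := by
  rw [pair_u_succ_one, pair_u_succ_zero, mul_zero]

lemma pair_Y_succ (m : ℕ) (n : ℤ) : pair (Y q s : Dual q) (m + 1) n = 0 := by
  simp [Y_eq, pair_mul_eq_zero_left (pair_b q s), pair_mul_of_degree_zero_left (pair_d_succ q s),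
    pair_d_succ]

lemma pair_Y_zero (n : ℤ) : pair (Y q s : Dual q) 0 n = (((q⁻¹ ^ 2) ^ n : Kˣ) : K) := by
  simp only [Y_eq, Subalgebra.coe_add, Subalgebra.coe_mul, Subalgebra.coe_smul, pair_add,
    pair_smul, pair_mul_zero, pair_b, pair_d_zero, mul_zero, add_zero]
  rw [← Units.val_mul, ← mul_zpow, sq]

lemma actL_k_X : actL q s (Uq.k q) (X q s) = ((q : K) ^ 2) • X q s := by
  simp only [X_eq, map_add, map_smul, actL_k_mul, actL_k_u_zero, smul_mul_assoc, mul_smul_comm]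
  module

lemma actL_k_Y : actL q s (Uq.k q) (Y q s) = ((q : K)⁻¹ ^ 2) • Y q s := by
  simp only [Y_eq, map_add, map_smul, actL_k_mul, actL_k_u_one, smul_mul_assoc, mul_smul_comm]
  module

lemma actL_k_W :
    actL q s (Uq.k q) ((q : K)⁻¹ • X q s + (q : K) • Y q s) =
      ((q : K)⁻¹ • X q s + (q : K) • Y q s) -
        ((q : K) - (q : K)⁻¹) • (Y q s - X q s) := by
  have hq0 : (q : K) ≠ 0 := q.ne_zero
  rw [map_add, map_smul, map_smul, actL_k_X, actL_k_Y]
  match_scalars <;> field_simp <;> ring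

lemma actL_k_pow_Y (N : ℕ) :
    actL q s (Uq.k q ^ N) (Y q s) = ((q : K)⁻¹ ^ 2) ^ N • Y q s := by
  induction N with
  | zero => rw [pow_zero, actL_one_left, pow_zero, one_smul]
  | succ N ih => rw [pow_succ', actL_mul_left, ih, map_smul, actL_k_Y, smul_smul, ← pow_succ]

variable [Algebra ℂ K]

lemma actL_k_Z : actL q s (Uq.k q) (Z q s) = Z q s := by
  have hq : (q : K) ≠ 0 := q.ne_zero
  simp only [Z_eq, map_add, map_smul, actL_k_mul, actL_k_u_zero, actL_k_u_one, smul_mul_assoc,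
    mul_smul_comm]
  match_scalars <;> field_simp

lemma actL_k_pow_Z (N : ℕ) : actL q s (Uq.k q ^ N) (Z q s) = Z q s := by
  induction N with
  | zero => rw [pow_zero, actL_one_left]
  | succ N ih => rw [pow_succ', actL_mul_left, ih, actL_k_Z]

lemma pair_Z_zero (n : ℤ) : pair (Z q s : Dual q) 0 n = 0 := by
  simp [Z_eq, pair_mul_zero, pair_b, pair_c_zero]

lemma pair_Z_add_two (m : ℕ) (n : ℤ) : pair (Z q s : Dual q) (m + 2) n = 0 := by
  simp [Z_eq, pair_mul_eq_zero_left (pair_b q s), pair_mul_of_degree_zero_left (pair_d_succ q s),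
    pair_c_add_two]

lemma pair_Z_one {q s : Kˣ} (hs : s ^ 2 = q) (n : ℤ) :
    pair (Z q s : Dual q) 1 n = im K * s := by
  have h : ((q⁻¹ ^ n : Kˣ) : K) * ((q ^ n : Kˣ) : K) = 1 := by
    rw [← Units.val_mul, ← mul_zpow, inv_mul_cancel, one_zpow, Units.val_one]
  have hq : (q : K) = (s : K) ^ 2 := by rw [← hs]; simp
  have hs0 : (s : K) ≠ 0 := s.ne_zero
  simp only [Z_eq, Subalgebra.coe_add, Subalgebra.coe_mul, Subalgebra.coe_smul, pair_add,
    pair_smul, pair_mul_eq_zero_left (pair_b q s), pair_mul_of_degree_zero_left (pair_d_succ q s),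
    pair_c_one, pair_d_zero, add_zero]
  calc im K * ((q : K) * (((q⁻¹ ^ n : Kˣ) : K) * ((s : K)⁻¹ * ((q ^ n : Kˣ) : K)))) =
      im K * ((q : K) * (s : K)⁻¹) * (((q⁻¹ ^ n : Kˣ) : K) * ((q ^ n : Kˣ) : K)) := by ring
    _ = im K * s := by rw [h, hq]; field_simp

lemma actL_theta_mul (y y' : Oq q s) : actL q s (theta q s) (y * y') =
    actL q s (theta q s) y * y' + actL q s (Uq.k q) y * actL q s (theta q s) y' := by
  ext1
  simp [dualL_mul, comul_theta, dualL_one_left]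

lemma actL_theta_u_one (i : Fin 2) :
    actL q s (theta q s) (uMat q s i 1) = im K • uMat q s i 0 := by
  ext1
  simp [uMat, dualL_coeff, theta, vecRep, smul_smul]

lemma actL_theta_u_zero {q s : Kˣ} (hs : s ^ 2 = q) (i : Fin 2) :
    actL q s (theta q s) (uMat q s i 0) = -im K • uMat q s i 1 := by
  subst hs
  ext1
  have hs0 : (s : K) ≠ 0 := s.ne_zero
  simp [uMat, dualL_coeff, theta, vecRep, smul_smul]
  field_simp

lemma actL_theta_Z {q s : Kˣ} (hs : s ^ 2 = q) :
    actL q s (theta q s) (Z q s) = Y q s - X q s := by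
  have hq : (q : K) ≠ 0 := q.ne_zero
  have hi := im_mul_im (K := K)
  simp only [Z_eq, X_eq, Y_eq, map_add, map_smul, actL_theta_mul, actL_theta_u_one,
    actL_theta_u_zero hs, actL_k_u_one, smul_mul_assoc, mul_smul_comm]
  match_scalars <;> field_simp <;> first
    | linear_combination hi
    | linear_combination -hi

lemma actL_theta_X_Y {q s : Kˣ} (hs : s ^ 2 = q) :
    (q : K)⁻¹ • actL q s (theta q s) (X q s) + (q : K) • actL q s (theta q s) (Y q s) = 0 := by
  have hq : (q : K) ≠ 0 := q.ne_zero
  simp only [X_eq, Y_eq, map_add, map_smul, actL_theta_mul, actL_theta_u_one,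
    actL_theta_u_zero hs, actL_k_u_zero, actL_k_u_one, smul_mul_assoc, mul_smul_comm]
  match_scalars <;> field_simp <;> ring

end coeff

/-! ### The algebra `O_q(K\U)` -/

section theta

variable [Algebra ℂ K]

/-- `O_q(K\U)` as a subalgebra of `O_q(SL(2))`. -/
def invSubalgebra (q s : Kˣ) : Subalgebra K (Oq q s) where
  carrier := OqKU q s
  mul_mem' {y y'} hy hy' := by
    have h : actR q s (theta q s) y = 0 := hy
    have h' : actR q s (theta q s) y' = 0 := hy'
    change actR q s (theta q s) (y * y') = 0
    rw [actR_theta_mul, h, h', zero_mul, mul_zero, add_zero]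
  add_mem' {y y'} hy hy' := by
    have h : actR q s (theta q s) y = 0 := hy
    have h' : actR q s (theta q s) y' = 0 := hy'
    change actR q s (theta q s) (y + y') = 0
    rw [map_add, h, h', add_zero]
  algebraMap_mem' r := by
    change actR q s (theta q s) _ = 0
    rw [Algebra.algebraMap_eq_smul_one, map_smul, actR_one]
    simp [theta]

lemma actL_mem {q s : Kˣ} {y : Oq q s} (hy : y ∈ invSubalgebra q s) (x : Uq q) :
    actL q s x y ∈ invSubalgebra q s := by
  have h : actR q s (theta q s) y = 0 := hy
  change actR q s (theta q s) (actL q s x y) = 0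
  rw [actR_actL, h, map_zero]

variable {q s : Kˣ}

lemma eq_of_pair_eq (hq : ∀ n : ℕ, 0 < n → q ^ n ≠ 1) {y y' : Oq q s}
    (hy : y ∈ invSubalgebra q s) (hy' : y' ∈ invSubalgebra q s)
    (h : ∀ i j, pair (y : Dual q) i j = pair (y' : Dual q) i j) : y = y' :=
  sub_eq_zero.1 <| eq_zero_of_pair_eq_zero (q_sub_inv_ne_zero hq)
    ((invSubalgebra q s).sub_mem hy hy') fun i j => by simp [h]

/-- `Z` is a normal element of `O_q(K\U)`, with the action of `k` as its automorphism. -/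
lemma mul_Z (hs : s ^ 2 = q) (hq : ∀ n : ℕ, 0 < n → q ^ n ≠ 1) {y : Oq q s}
    (hy : y ∈ invSubalgebra q s) : y * Z q s = Z q s * actL q s (Uq.k q) y := by
  have hZ : Z q s ∈ invSubalgebra q s := Z_mem q s hs
  refine eq_of_pair_eq hq (mul_mem hy hZ) (mul_mem hZ (actL_mem hy _)) fun i j => ?_
  obtain _ | i := i
  · simp [pair_mul_zero, pair_Z_zero]
  · rw [Subalgebra.coe_mul, Subalgebra.coe_mul, pair_mul_of_degree_one_right (pair_Z_zero q s)
      (pair_Z_one hs) (pair_Z_add_two q s), pair_mul_of_degree_one_left (pair_Z_zero q s)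
      (pair_Z_add_two q s), pair_Z_one hs, coe_actL, pair_dualL_k, sub_add_cancel]

lemma eq_zero_of_Z_mul (hs : s ^ 2 = q) (hq : ∀ n : ℕ, 0 < n → q ^ n ≠ 1) {y : Oq q s}
    (hy : y ∈ invSubalgebra q s) (h : Z q s * y = 0) : y = 0 := by
  refine eq_of_pair_eq hq hy (zero_mem _) fun i j => ?_
  have h1 := congr_arg (fun z : Oq q s => pair (z : Dual q) (i + 1) (j + 1)) h
  simp only [Subalgebra.coe_mul, pair_mul_of_degree_one_left (pair_Z_zero q s)
    (pair_Z_add_two q s), pair_Z_one hs, add_sub_cancel_right, Subalgebra.coe_zero, pair_zero,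
    mul_eq_zero, qNum_ne_zero hq, im_ne_zero, s.ne_zero, false_or] at h1
  simpa using h1

lemma pair_Z_pow_of_ne (N : ℕ) (i : ℕ) (j : ℤ) (h : i ≠ N) :
    pair ((Z q s ^ N : Oq q s) : Dual q) i j = 0 := by
  induction N generalizing i j with
  | zero =>
    obtain ⟨i, rfl⟩ := Nat.exists_eq_succ_of_ne_zero h
    have h0 : dualR q (Uq.F q) (1 : Dual q) = 0 := by simp [dualR_one]
    rw [pow_zero, Subalgebra.coe_one, Nat.succ_eq_add_one, ← pair_dualR_F, h0, pair_zero]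
  | succ N ih =>
    rw [pow_succ', Subalgebra.coe_mul]
    obtain _ | i := i
    · rw [pair_mul_zero, pair_Z_zero, zero_mul]
    · rw [pair_mul_of_degree_one_left (pair_Z_zero q s) (pair_Z_add_two q s),
        ih i _ (by omega), mul_zero]

lemma pair_Z_pow_self (hs : s ^ 2 = q) (hq : ∀ n : ℕ, 0 < n → q ^ n ≠ 1) (N : ℕ) :
    ∃ c : K, c ≠ 0 ∧ ∀ j, pair ((Z q s ^ N : Oq q s) : Dual q) N j = c := by
  induction N with
  | zero =>
    refine ⟨1, one_ne_zero, fun j => ?_⟩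
    rw [pow_zero, Subalgebra.coe_one, pair_of_dualL_k (c := 1) (by simp [dualL_one])]
    simp [pair, Dual.eval_one]
  | succ N ih =>
    obtain ⟨c, hc, h⟩ := ih
    refine ⟨qNum q (N + 1) * (im K * s) * c, mul_ne_zero (mul_ne_zero (qNum_ne_zero hq N)
      (mul_ne_zero im_ne_zero s.ne_zero)) hc, fun j => ?_⟩
    rw [pow_succ', Subalgebra.coe_mul, pair_mul_of_degree_one_left (pair_Z_zero q s)
      (pair_Z_add_two q s), pair_Z_one hs, h]

/-- Elements of `O_q(K\U)` that commute with `Z` have values at `F^i k^j` that do not depend on `j`;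
the commutation with `Y` up to `q^{-2N}` makes those with `i ≠ N` vanish. -/
lemma eq_smul_Z_pow (hs : s ^ 2 = q) (hq : ∀ n : ℕ, 0 < n → q ^ n ≠ 1) {y : Oq q s}
    (hy : y ∈ invSubalgebra q s) (N : ℕ) (hZ : y * Z q s = Z q s * y)
    (hY : ((q : K)⁻¹ ^ 2) ^ N • (y * Y q s) = Y q s * y) : ∃ c : K, y = c • Z q s ^ N := by
  have hZm : Z q s ∈ invSubalgebra q s := Z_mem q s hs
  have hk : actL q s (Uq.k q) y = y := by
    refine sub_eq_zero.1 (eq_zero_of_Z_mul hs hq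
      ((invSubalgebra q s).sub_mem (actL_mem hy _) hy) ?_)
    rw [mul_sub, ← mul_Z hs hq hy, hZ, sub_self]
  have hj : ∀ i j, pair (y : Dual q) i j = pair (y : Dual q) i 0 := fun i j => by
    rw [pair_of_dualL_k (c := 1) (by simpa using congr_arg Subtype.val hk)]
    simp
  have hi : ∀ i, i ≠ N → pair (y : Dual q) i 0 = 0 := by
    intro i hiN
    have h := congr_arg (fun z : Oq q s => pair (z : Dual q) i 0) hY
    simp only [Subalgebra.coe_smul, Subalgebra.coe_mul, pair_smul,
      pair_mul_of_degree_zero_left (pair_Y_succ q s),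
      pair_mul_of_degree_zero_right (pair_Y_succ q s), pair_Y_zero, zpow_zero, Units.val_one,
      one_mul] at h
    by_contra hne
    -- otherwise `q^{-2N}` would be `q^{-2i}`, which is excluded as `q` is not a root of unity
    have h1 : ((q : K)⁻¹ ^ 2) ^ N * (((q⁻¹ ^ 2) ^ (0 - (i : ℤ)) : Kˣ) : K) = 1 :=
      mul_left_cancel₀ hne (by linear_combination h)
    have h2 : (q⁻¹ ^ 2) ^ N * (q⁻¹ ^ 2) ^ (0 - (i : ℤ)) = 1 := by
      ext
      simpa using h1
    have h3 : q ^ (2 * ((i : ℤ) - N)) = q ^ (0 : ℤ) := by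
      rw [zpow_zero, ← h2, ← zpow_natCast (q⁻¹ ^ 2) N, ← zpow_add, ← zpow_natCast q⁻¹ 2,
        inv_zpow', ← zpow_mul]
      congr 1
      push_cast
      ring
    have := zpow_injective_of_pow_ne_one hq h3
    omega
  obtain ⟨c, hc, hcN⟩ := pair_Z_pow_self hs hq N
  refine ⟨pair (y : Dual q) N 0 * c⁻¹, eq_of_pair_eq hq hy
    ((invSubalgebra q s).smul_mem (pow_mem hZm N) _) fun i j => ?_⟩
  rw [hj, Subalgebra.coe_smul, pair_smul]
  by_cases h : i = N
  · rw [h, hcN, inv_mul_cancel_right₀ hc]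
  · rw [hi i h, pair_Z_pow_of_ne N i j h, mul_zero]

/-- The operator `y ↦ w y - y w + (q - q⁻¹) Z (x ▷ y)`. -/
def twistedAd (q s : Kˣ) (w : Oq q s) (x : Uq q) (y : Oq q s) : Oq q s :=
  w * y - y * w + ((q : K) - (q : K)⁻¹) • (Z q s * actL q s x y)

lemma twistedAd_mem (hs : s ^ 2 = q) {w y : Oq q s} (hw : w ∈ invSubalgebra q s) (x : Uq q)
    (hy : y ∈ invSubalgebra q s) : twistedAd q s w x y ∈ invSubalgebra q s := by
  have hZ : Z q s ∈ invSubalgebra q s := Z_mem q s hs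
  exact add_mem (sub_mem (mul_mem hw hy) (mul_mem hy hw))
    (Subalgebra.smul_mem _ (mul_mem hZ (actL_mem hy x)) _)

lemma twistedAd_add (w w' : Oq q s) (x x' : Uq q) (y : Oq q s) :
    twistedAd q s (w + w') (x + x') y = twistedAd q s w x y + twistedAd q s w' x' y := by
  simp only [twistedAd, add_mul, mul_add, map_add, LinearMap.add_apply, smul_add]
  abel

lemma actL_k_twistedAd {w : Oq q s} {x : Uq q} {c : K}
    (hw : actL q s (Uq.k q) w = c • w) (hx : Uq.k q * x = c • (x * Uq.k q)) (y : Oq q s) :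
    actL q s (Uq.k q) (twistedAd q s w x y) =
      c • twistedAd q s w x (actL q s (Uq.k q) y) := by
  simp only [twistedAd, map_add, map_sub, map_smul, actL_k_mul, hw, actL_k_Z, ← actL_mul_left, hx,
    LinearMap.smul_apply, smul_mul_assoc, mul_smul_comm]
  module

/-- The twisted derivation by which `θ` acts and an inner derivation add up to a derivation that
vanishes on `Z`. As `Z` is normal, it commutes with the action of `k`; but its two parts scale the
weights by `q²` and by `q⁻²`. Hence it is zero. -/
lemma twistedAd_theta_eq_zero (hs : s ^ 2 = q) (hq : ∀ n : ℕ, 0 < n → q ^ n ≠ 1) {y : Oq q s}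
    (hy : y ∈ invSubalgebra q s) :
    twistedAd q s ((q : K)⁻¹ • X q s + (q : K) • Y q s) (theta q s) y = 0 := by
  have hq0 : (q : K) ≠ 0 := q.ne_zero
  have hq2 := q_pow_ne_one hq (n := 2) (by norm_num)
  have hq4 := q_pow_ne_one hq (n := 4) (by norm_num)
  have hX : X q s ∈ invSubalgebra q s := X_mem q s hs
  have hY : Y q s ∈ invSubalgebra q s := Y_mem q s hs
  have hZ : Z q s ∈ invSubalgebra q s := Z_mem q s hs
  set W := (q : K)⁻¹ • X q s + (q : K) • Y q s with hW
  have hWm : W ∈ invSubalgebra q s :=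
    add_mem (Subalgebra.smul_mem _ hX _) (Subalgebra.smul_mem _ hY _)
  have hTZ : twistedAd q s W (theta q s) (Z q s) = 0 := by
    rw [twistedAd, mul_Z hs hq hWm, actL_theta_Z hs, ← mul_sub, ← mul_smul_comm, ← mul_add]
    convert mul_zero (Z q s)
    rw [actL_k_W]
    module
  have hder : ∀ y y' : Oq q s, y ∈ invSubalgebra q s → twistedAd q s W (theta q s) (y * y') =
      twistedAd q s W (theta q s) y * y' + y * twistedAd q s W (theta q s) y' := by
    intro y y' hy
    have h : y * (Z q s * actL q s (theta q s) y') =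
        Z q s * (actL q s (Uq.k q) y * actL q s (theta q s) y') := by
      rw [← mul_assoc, mul_Z hs hq hy, mul_assoc]
    simp only [twistedAd, actL_theta_mul, mul_add, add_mul, mul_sub, sub_mul, smul_add,
      smul_mul_assoc, mul_smul_comm, h, mul_assoc]
    abel
  have hcomm : ∀ y ∈ invSubalgebra q s, actL q s (Uq.k q) (twistedAd q s W (theta q s) y) =
      twistedAd q s W (theta q s) (actL q s (Uq.k q) y) := by
    intro y hy
    refine sub_eq_zero.1 (eq_zero_of_Z_mul hs hq (sub_mem (actL_mem
      (twistedAd_mem hs hWm _ hy) _) (twistedAd_mem hs hWm _ (actL_mem hy _))) ?_)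
    have h := hder y (Z q s) hy
    rw [mul_Z hs hq hy, hder _ _ hZ, hTZ, zero_mul, zero_add, mul_zero, add_zero,
      mul_Z hs hq (twistedAd_mem hs hWm _ hy)] at h
    rw [mul_sub, h, sub_self]
  -- the parts of the operator that come from `E` and from `F k`
  set A := twistedAd q s ((q : K)⁻¹ • X q s) ((im K * (s : K)⁻¹) • Uq.E q) with hA
  set B := twistedAd q s ((q : K) • Y q s) (-((im K * (s : K)⁻¹) • (Uq.F q * Uq.k q))) with hB
  have hsplit : ∀ y, twistedAd q s W (theta q s) y = A y + B y := fun y => by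
    rw [hA, hB, ← twistedAd_add, ← hW, ← sub_eq_add_neg, ← smul_sub, theta]
  have hkA : ∀ y, actL q s (Uq.k q) (A y) = ((q : K) ^ 2) • A (actL q s (Uq.k q) y) :=
    actL_k_twistedAd (by rw [map_smul, actL_k_X, smul_comm])
      (by rw [mul_smul_comm, Uq.k_mul_E, smul_mul_assoc, smul_comm])
  have hkB : ∀ y, actL q s (Uq.k q) (B y) = ((q : K)⁻¹ ^ 2) • B (actL q s (Uq.k q) y) :=
    actL_k_twistedAd (by rw [map_smul, actL_k_Y, smul_comm])
      (by rw [mul_neg, mul_smul_comm, ← mul_assoc, Uq.k_mul_F, smul_mul_assoc, neg_mul,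
        smul_mul_assoc, smul_comm, smul_neg])
  have hAB : ∀ y ∈ invSubalgebra q s, B y = ((q : K) ^ 2) • A y := by
    intro y hy
    have h := hcomm _ (actL_mem hy (Uq.kinv q))
    rw [hsplit, hsplit, map_add, hkA, hkB, actL_k_kinv] at h
    have h1 : (((q : K) ^ 2 - 1) * (q : K)⁻¹ ^ 2) • (B y - ((q : K) ^ 2) • A y) = 0 := by
      have h2 : ((q : K) ^ 2) • A y + ((q : K)⁻¹ ^ 2) • B y - (A y + B y) = 0 :=
        sub_eq_zero.2 h
      rw [← neg_eq_zero, ← h2]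
      match_scalars <;> field_simp
      ring
    exact sub_eq_zero.1 ((smul_eq_zero.1 h1).resolve_left
      (mul_ne_zero (sub_ne_zero.2 hq2) (pow_ne_zero _ (inv_ne_zero hq0))))
  have hA0 : ∀ y ∈ invSubalgebra q s, A y = 0 := by
    intro y hy
    have hy' := actL_mem hy (Uq.kinv q)
    have h := congr_arg (actL q s (Uq.k q)) (hAB _ hy')
    rw [map_smul, hkA, hkB, actL_k_kinv, hAB _ hy] at h
    have h1 : ((q : K) ^ 4 - 1) • A y = 0 := by
      have h2 := sub_eq_zero.2 h
      rw [← neg_eq_zero, ← h2]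
      match_scalars
      field_simp
      ring
    exact (smul_eq_zero.1 h1).resolve_left (sub_ne_zero.2 hq4)
  rw [hsplit, hAB _ hy, hA0 _ hy, smul_zero, add_zero]

end theta

variable [Algebra ℂ K]

/-! ### The filtration of `U_q(𝔤)` by the degree in `θ` -/

/-- The span of the elements `y θⁿ` of the Drinfeld double with `y ∈ O_q(K\U)` and `n < N`. -/
def fil (q s : Kˣ) (N : ℕ) : Submodule K (Double q s) :=
  Submodule.span K {z | ∃ n < N, ∃ y ∈ invSubalgebra q s,
    z = Double.ofO q s y * Double.ofU q s (theta q s) ^ n}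

variable {q s : Kˣ}

/-- The commutation rule in `U_q(𝔤)`, which makes it an Ore extension of `O_q(K\U)`. -/
lemma theta_mul_ofO {y : Oq q s} (hy : y ∈ invSubalgebra q s) :
    Double.ofU q s (theta q s) * Double.ofO q s y =
      Double.ofO q s (actL q s (Uq.k q) y) * Double.ofU q s (theta q s) +
        Double.ofO q s (actL q s (theta q s) y) := by
  have hU : ∀ x, Double.mk q s (preU q s x) = Double.ofU q s x := fun _ => rfl
  have hO : ∀ x, Double.mk q s (preO q s x) = Double.ofO q s x := fun _ => rfl
  have h := Double.mk_rel q s (.exchange (theta q s) y)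
  have hy' : actR q s (theta q s) y = 0 := hy
  simp only [comul_theta, map_add, TensorProduct.map_tmul, LinearMap.mul'_apply,
    LinearMap.comp_apply, LinearMap.flip_apply, map_mul, hU, hO, hy', actR_one_left, map_one,
    mul_one, map_zero, mul_zero, add_zero] at h
  rw [← h, add_comm]

lemma ofO_mul_pow_mem_fil {y : Oq q s} (hy : y ∈ invSubalgebra q s) {n N : ℕ} (h : n < N) :
    Double.ofO q s y * Double.ofU q s (theta q s) ^ n ∈ fil q s N :=
  Submodule.subset_span ⟨n, h, y, hy, rfl⟩

lemma fil_mono : Monotone (fil q s) := fun _ _ h =>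
  Submodule.span_mono fun _ ⟨n, hn, y, hy, hz⟩ => ⟨n, hn.trans_le h, y, hy, hz⟩

lemma fil_zero : fil q s 0 = ⊥ := by
  simp [fil]

lemma ofO_mul_mem_fil {y : Oq q s} (hy : y ∈ invSubalgebra q s) {N : ℕ} {z : Double q s}
    (hz : z ∈ fil q s N) : Double.ofO q s y * z ∈ fil q s N := by
  suffices h : fil q s N ≤ (fil q s N).comap (LinearMap.mulLeft K (Double.ofO q s y)) from h hz
  refine Submodule.span_le.2 ?_
  rintro _ ⟨n, hn, y', hy', rfl⟩
  simpa [mul_assoc] using ofO_mul_pow_mem_fil (mul_mem hy hy') hn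

lemma mul_theta_mem_fil {N : ℕ} {z : Double q s} (hz : z ∈ fil q s N) :
    z * Double.ofU q s (theta q s) ∈ fil q s (N + 1) := by
  suffices h : fil q s N ≤
    (fil q s (N + 1)).comap (LinearMap.mulRight K (Double.ofU q s (theta q s))) from h hz
  refine Submodule.span_le.2 ?_
  rintro _ ⟨n, hn, y', hy', rfl⟩
  simpa [mul_assoc, ← pow_succ] using ofO_mul_pow_mem_fil hy' (Nat.succ_lt_succ hn)

lemma theta_mul_mem_fil {N : ℕ} {z : Double q s} (hz : z ∈ fil q s N) :
    Double.ofU q s (theta q s) * z ∈ fil q s (N + 1) := by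
  suffices h : fil q s N ≤
    (fil q s (N + 1)).comap (LinearMap.mulLeft K (Double.ofU q s (theta q s))) from h hz
  refine Submodule.span_le.2 ?_
  rintro _ ⟨n, hn, y, hy, rfl⟩
  change Double.ofU q s (theta q s) * (_ * _) ∈ fil q s (N + 1)
  rw [← mul_assoc, theta_mul_ofO hy, add_mul, mul_assoc, ← pow_succ']
  exact add_mem (ofO_mul_pow_mem_fil (actL_mem hy _) (Nat.succ_lt_succ hn))
    (ofO_mul_pow_mem_fil (actL_mem hy _) (hn.trans N.lt_succ_self))

/-- `θⁿ y = σⁿ(y) θⁿ` up to terms of lower degree. -/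
lemma theta_pow_mul_ofO {y : Oq q s} (hy : y ∈ invSubalgebra q s) (n : ℕ) :
    Double.ofU q s (theta q s) ^ n * Double.ofO q s y -
      Double.ofO q s (actL q s (Uq.k q ^ n) y) * Double.ofU q s (theta q s) ^ n ∈ fil q s n := by
  induction n with
  | zero => simp [actL_one_left]
  | succ n ih =>
    have h := add_mem (theta_mul_mem_fil ih) (ofO_mul_pow_mem_fil
      (actL_mem (actL_mem hy (Uq.k q ^ n)) (theta q s)) n.lt_succ_self)
    rw [mul_sub, ← mul_assoc _ (Double.ofO q s _) _, theta_mul_ofO (actL_mem hy _),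
      ← actL_mul_left q s (Uq.k q), ← pow_succ', ← mul_assoc, ← pow_succ', add_mul, mul_assoc,
      ← pow_succ'] at h
    convert h using 1
    abel

lemma mul_ofO_mem_fil {y : Oq q s} (hy : y ∈ invSubalgebra q s) {N : ℕ} {z : Double q s}
    (hz : z ∈ fil q s N) : z * Double.ofO q s y ∈ fil q s N := by
  suffices h : fil q s N ≤ (fil q s N).comap (LinearMap.mulRight K (Double.ofO q s y)) from h hz
  refine Submodule.span_le.2 ?_
  rintro _ ⟨n, hn, y', hy', rfl⟩
  change _ * _ * Double.ofO q s y ∈ fil q s N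
  have h := add_mem (ofO_mul_mem_fil hy' (fil_mono hn.le (theta_pow_mul_ofO hy n)))
    (ofO_mul_mem_fil hy' (ofO_mul_pow_mem_fil (actL_mem hy (Uq.k q ^ n)) hn))
  rwa [← mul_add, sub_add_cancel, ← mul_assoc] at h

/-- The leading coefficient of an element of the filtration. -/
lemma exists_leadingCoeff {N : ℕ} {z : Double q s} (hz : z ∈ fil q s (N + 1)) :
    ∃ y ∈ invSubalgebra q s,
      z - Double.ofO q s y * Double.ofU q s (theta q s) ^ N ∈ fil q s N := by
  induction hz using Submodule.span_induction with
  | mem z hz =>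
    obtain ⟨n, hn, y, hy, rfl⟩ := hz
    obtain h | rfl := (Nat.lt_succ_iff.1 hn).lt_or_eq
    · exact ⟨0, zero_mem _, by simpa using ofO_mul_pow_mem_fil hy h⟩
    · exact ⟨y, hy, by simp⟩
  | zero => exact ⟨0, zero_mem _, by simp⟩
  | add z z' _ _ h h' =>
    obtain ⟨y, hy, h⟩ := h
    obtain ⟨y', hy', h'⟩ := h'
    refine ⟨y + y', add_mem hy hy', ?_⟩
    rw [map_add, add_mul, add_sub_add_comm]
    exact add_mem h h'
  | smul c z _ h =>
    obtain ⟨y, hy, h⟩ := h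
    refine ⟨c • y, Subalgebra.smul_mem _ hy _, ?_⟩
    rw [map_smul, smul_mul_assoc, ← smul_sub]
    exact Submodule.smul_mem _ _ h

/-- The powers of `θ` are linearly independent over `O_q(SL(2))`: the value at `0` of the sequence
obtained by applying `θⁿ` to the `N`-th standard sequence is zero for `n < N`, but not for
`n = N`. -/
lemma eq_zero_of_ofO_mul_theta_pow_mem (hq : ∀ n : ℕ, 0 < n → q ^ n ≠ 1) {N : ℕ} {y : Oq q s}
    (h : Double.ofO q s y * Double.ofU q s (theta q s) ^ N ∈ fil q s N) : y = 0 := by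
  have hq' := q_sub_inv_ne_zero hq
  have hval : ∀ (y : Oq q s) (n : ℕ), ∃ v : K,
      repD hq' s (Double.ofO q s y * Double.ofU q s (theta q s) ^ n) (Pi.single N 1) 0 = v • y ∧
      (n < N → v = 0) ∧ (n = N → v = (im K * (s : K)⁻¹) ^ n) := by
    intro y n
    obtain ⟨v, hv, h0, h1⟩ := repU_theta_pow_single hq' s N n
    refine ⟨v 0, ?_, fun hn => h0 0 (by omega), fun hn => h1 0 (by omega)⟩
    rw [map_mul, map_pow, repD_ofO, repD_ofU, Module.End.mul_apply, hv, repO_apply,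
      mul_smul_comm, mul_one]
  have hfil : ∀ z ∈ fil q s N, repD hq' s z (Pi.single N 1) 0 = 0 := by
    intro z hz
    induction hz using Submodule.span_induction with
    | mem z hz =>
      obtain ⟨n, hn, y, hy, rfl⟩ := hz
      obtain ⟨v, hv, h0, -⟩ := hval y n
      rw [hv, h0 hn, zero_smul]
    | zero => simp
    | add z z' _ _ h h' => simp [h, h']
    | smul c z _ h => simp [h]
  obtain ⟨v, hv, -, h1⟩ := hval y N
  have h2 := hfil _ h
  rw [hv, h1 rfl] at h2
  exact (smul_eq_zero.1 h2).resolve_left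
    (pow_ne_zero _ (mul_ne_zero im_ne_zero (inv_ne_zero s.ne_zero)))

/-- The filtration exhausts `U_q(𝔤)`: multiplication from the right by a generator raises the
degree in `θ` at most by one. -/
lemma exists_mem_fil {z : Double q s} (hz : z ∈ Ug q s) : ∃ N, z ∈ fil q s N := by
  let R : Subalgebra K (Double q s) :=
    { carrier := {x | ∀ N, ∀ z ∈ fil q s N, ∃ N', z * x ∈ fil q s N'}
      mul_mem' := fun {x x'} hx hx' N z hz => by
        obtain ⟨N', h⟩ := hx N z hz
        simpa only [mul_assoc] using hx' N' _ h
      add_mem' := fun {x x'} hx hx' N z hz => by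
        obtain ⟨n, h⟩ := hx N z hz
        obtain ⟨n', h'⟩ := hx' N z hz
        exact ⟨max n n', by
          rw [mul_add]
          exact add_mem (fil_mono (le_max_left _ _) h) (fil_mono (le_max_right _ _) h')⟩
      algebraMap_mem' := fun r N z hz => ⟨N, by
        rw [← Algebra.commutes, ← Algebra.smul_def]
        exact Submodule.smul_mem _ _ hz⟩ }
  have hU : Uk q s ≤ R.comap (Double.ofU q s) :=
    Algebra.adjoin_le (Set.singleton_subset_iff.2 fun N z hz => ⟨N + 1, mul_theta_mem_fil hz⟩)
  have hR : Ug q s ≤ R := by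
    refine Algebra.adjoin_le ?_
    rintro _ (⟨x, hx, rfl⟩ | ⟨y, hy, rfl⟩)
    · exact hU hx
    · exact fun N z hz => ⟨N, mul_ofO_mem_fil hy hz⟩
  have h1 : (1 : Double q s) ∈ fil q s 1 := by
    simpa using ofO_mul_pow_mem_fil (one_mem (invSubalgebra q s)) one_pos
  simpa using hR hz 1 1 h1

/-! ### The Casimir element and the center -/

/-- The Casimir element with `θ` moved to the right. -/
lemma coe_casimir (hs : s ^ 2 = q) : (casimir q s hs : Double q s) =
    ((q : K) - (q : K)⁻¹) • (Double.ofO q s (Z q s) * Double.ofU q s (theta q s)) +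
      Double.ofO q s ((q : K)⁻¹ • X q s + (q : K) • Y q s) := by
  have hZ : Z q s ∈ invSubalgebra q s := Z_mem q s hs
  have h : (casimir q s hs : Double q s) = (q : K) • Double.ofO q s (X q s) +
      (q : K)⁻¹ • Double.ofO q s (Y q s) + ((q : K) - (q : K)⁻¹) •
        (Double.ofU q s (theta q s) * Double.ofO q s (Z q s)) := rfl
  rw [h, theta_mul_ofO hZ, actL_k_Z, actL_theta_Z hs, map_add, map_smul, map_smul, map_sub]
  module

lemma casimir_mul_ofO (hs : s ^ 2 = q) (hq : ∀ n : ℕ, 0 < n → q ^ n ≠ 1) {y : Oq q s}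
    (hy : y ∈ invSubalgebra q s) : (casimir q s hs : Double q s) * Double.ofO q s y =
      Double.ofO q s y * (casimir q s hs : Double q s) := by
  have h := congr_arg (Double.ofO q s) (twistedAd_theta_eq_zero hs hq hy)
  have hZ := congr_arg (Double.ofO q s) (mul_Z hs hq hy)
  rw [twistedAd, map_add, map_sub, map_mul, map_mul, map_smul, map_mul, map_zero] at h
  rw [map_mul, map_mul] at hZ
  rw [coe_casimir, add_mul, mul_add, smul_mul_assoc, mul_assoc, theta_mul_ofO hy, mul_add,
    ← mul_assoc, ← hZ, mul_smul_comm, mul_assoc, ← sub_eq_zero, ← h]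
  module

lemma casimir_mul_theta (hs : s ^ 2 = q) : (casimir q s hs : Double q s) *
    Double.ofU q s (theta q s) = Double.ofU q s (theta q s) * (casimir q s hs : Double q s) := by
  have hZ : Z q s ∈ invSubalgebra q s := Z_mem q s hs
  have hW : (q : K)⁻¹ • X q s + (q : K) • Y q s ∈ invSubalgebra q s :=
    add_mem (Subalgebra.smul_mem _ (X_mem q s hs) _) (Subalgebra.smul_mem _ (Y_mem q s hs) _)
  rw [coe_casimir, mul_add, mul_smul_comm, ← mul_assoc, theta_mul_ofO hZ, theta_mul_ofO hW,
    actL_k_W, map_add (actL q s (theta q s)), map_smul, map_smul, actL_theta_X_Y hs, actL_k_Z,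
    actL_theta_Z hs, map_zero, add_zero]
  simp only [map_sub, map_smul, add_mul, sub_mul, smul_mul_assoc, smul_add, smul_sub]
  abel

lemma casimir_mem_center (hs : s ^ 2 = q) (hq : ∀ n : ℕ, 0 < n → q ^ n ≠ 1) :
    casimir q s hs ∈ Subalgebra.center K (Ug q s) := by
  have hU : Uk q s ≤
      (Subalgebra.centralizer K {(casimir q s hs : Double q s)}).comap (Double.ofU q s) := by
    refine Algebra.adjoin_le (Set.singleton_subset_iff.2 ?_)
    change _ ∈ Subalgebra.centralizer K {(casimir q s hs : Double q s)}
    rw [Subalgebra.mem_centralizer_iff]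
    rintro _ rfl
    exact casimir_mul_theta hs
  have h : Ug q s ≤ Subalgebra.centralizer K {(casimir q s hs : Double q s)} := by
    refine Algebra.adjoin_le ?_
    rintro _ (⟨x, hx, rfl⟩ | ⟨y, hy, rfl⟩)
    · exact hU hx
    · rw [SetLike.mem_coe, Subalgebra.mem_centralizer_iff]
      rintro _ rfl
      exact casimir_mul_ofO hs hq hy
  rw [Subalgebra.mem_center_iff]
  intro b
  ext1
  exact ((Subalgebra.mem_centralizer_iff K).1 (h b.2) _ rfl).symm

/-- The leading coefficient of `Ωᴺ` is `(q - q⁻¹)ᴺ Zᴺ`. -/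
lemma casimir_pow_sub_mem_fil (hs : s ^ 2 = q) (hq : ∀ n : ℕ, 0 < n → q ^ n ≠ 1) (N : ℕ) :
    (casimir q s hs : Double q s) ^ N - ((q : K) - (q : K)⁻¹) ^ N •
      (Double.ofO q s (Z q s ^ N) * Double.ofU q s (theta q s) ^ N) ∈ fil q s N := by
  have hZ : Z q s ∈ invSubalgebra q s := Z_mem q s hs
  have hW : (q : K)⁻¹ • X q s + (q : K) • Y q s ∈ invSubalgebra q s :=
    add_mem (Subalgebra.smul_mem _ (X_mem q s hs) _) (Subalgebra.smul_mem _ (Y_mem q s hs) _)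
  induction N with
  | zero => simp
  | succ N ih =>
    set l := (q : K) - (q : K)⁻¹
    set t := Double.ofU q s (theta q s)
    set w := (q : K)⁻¹ • X q s + (q : K) • Y q s
    -- multiply the leading term for `N` from the left by `Ω = (q - q⁻¹) Z θ + W`
    have hmul : ∀ z ∈ fil q s N, (casimir q s hs : Double q s) * z ∈ fil q s (N + 1) := by
      intro z hz
      rw [coe_casimir, add_mul, smul_mul_assoc, mul_assoc]
      exact add_mem (Submodule.smul_mem _ _ (ofO_mul_mem_fil hZ (theta_mul_mem_fil hz)))
        (fil_mono N.le_succ (ofO_mul_mem_fil hW hz))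
    have h2 : (casimir q s hs : Double q s) * (l ^ N • (Double.ofO q s (Z q s ^ N) * t ^ N)) -
        l ^ (N + 1) • (Double.ofO q s (Z q s ^ (N + 1)) * t ^ (N + 1)) ∈ fil q s (N + 1) := by
      rw [mul_smul_comm, ← mul_assoc, casimir_mul_ofO hs hq (pow_mem hZ N), coe_casimir]
      have h3 : l ^ N • (Double.ofO q s (Z q s ^ N) * (l • (Double.ofO q s (Z q s) * t) +
          Double.ofO q s w) * t ^ N) - l ^ (N + 1) • (Double.ofO q s (Z q s ^ (N + 1)) *
          t ^ (N + 1)) = l ^ N • (Double.ofO q s (Z q s ^ N) * (Double.ofO q s w * t ^ N)) := by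
        rw [mul_add, add_mul, mul_smul_comm, smul_mul_assoc, smul_add, smul_smul, ← pow_succ,
          mul_assoc, mul_assoc, ← pow_succ', ← mul_assoc, ← map_mul, ← pow_succ, mul_assoc,
          add_sub_cancel_left]
      rw [h3]
      exact Submodule.smul_mem _ _ (ofO_mul_mem_fil (pow_mem hZ N)
        (ofO_mul_pow_mem_fil hW N.lt_succ_self))
    have h4 := add_mem (hmul _ ih) h2
    rwa [mul_sub, sub_add_sub_cancel, ← pow_succ'] at h4

/-- If an element of the filtration commutes with an element of `O_q(K\U)`, then its leading
coefficient commutes with it up to the action of a power of `k`. -/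
lemma leadingCoeff_mul (hq : ∀ n : ℕ, 0 < n → q ^ n ≠ 1) {N : ℕ} {z : Double q s} {y b : Oq q s}
    (hy : y ∈ invSubalgebra q s) (hb : b ∈ invSubalgebra q s)
    (hz : z - Double.ofO q s y * Double.ofU q s (theta q s) ^ N ∈ fil q s N)
    (hzb : z * Double.ofO q s b = Double.ofO q s b * z) :
    y * actL q s (Uq.k q ^ N) b = b * y := by
  refine sub_eq_zero.1 (eq_zero_of_ofO_mul_theta_pow_mem hq (N := N) ?_)
  have h := sub_mem (sub_mem (ofO_mul_mem_fil hb hz) (mul_ofO_mem_fil hb hz))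
    (ofO_mul_mem_fil hy (theta_pow_mul_ofO hb N))
  convert h using 1
  rw [map_sub, map_mul, map_mul]
  simp only [mul_sub, sub_mul, hzb, mul_assoc]
  abel

/-- An element of degree `N` in `θ` that commutes with `Y` and `Z` has leading coefficient
proportional to `Zᴺ`, so that a multiple of `Ωᴺ` can be subtracted to lower its degree. -/
lemma mem_adjoin_of_commute (hs : s ^ 2 = q) (hq : ∀ n : ℕ, 0 < n → q ^ n ≠ 1) (N : ℕ)
    {z : Double q s} (hz : z ∈ fil q s N)
    (hY : z * Double.ofO q s (Y q s) = Double.ofO q s (Y q s) * z)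
    (hZ : z * Double.ofO q s (Z q s) = Double.ofO q s (Z q s) * z) :
    z ∈ Algebra.adjoin K {(casimir q s hs : Double q s)} := by
  have hYm : Y q s ∈ invSubalgebra q s := Y_mem q s hs
  have hZm : Z q s ∈ invSubalgebra q s := Z_mem q s hs
  induction N generalizing z with
  | zero =>
    rw [fil_zero, Submodule.mem_bot] at hz
    rw [hz]
    exact zero_mem _
  | succ N ih =>
    obtain ⟨y, hy, hzy⟩ := exists_leadingCoeff hz
    have hyZ := leadingCoeff_mul hq hy hZm hzy hZ
    have hyY := leadingCoeff_mul hq hy hYm hzy hY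
    rw [actL_k_pow_Z] at hyZ
    rw [actL_k_pow_Y, mul_smul_comm] at hyY
    obtain ⟨c, rfl⟩ := eq_smul_Z_pow hs hq hy N hyZ hyY
    set l := (q : K) - (q : K)⁻¹ with hl
    have hl0 : l ^ N ≠ 0 := pow_ne_zero _ (q_sub_inv_ne_zero hq)
    set Ω := (casimir q s hs : Double q s) with hΩ
    have hΩN : Ω ^ N ∈ Algebra.adjoin K {Ω} := pow_mem (Algebra.self_mem_adjoin_singleton K Ω) N
    have hcomm : ∀ b ∈ invSubalgebra q s, Ω ^ N * Double.ofO q s b = Double.ofO q s b * Ω ^ N :=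
      fun b hb => (show Commute Ω (Double.ofO q s b) from casimir_mul_ofO hs hq hb).pow_left N
    have hlow : z - (c * (l ^ N)⁻¹) • Ω ^ N ∈ fil q s N := by
      have h := sub_mem hzy
        (Submodule.smul_mem _ (c * (l ^ N)⁻¹) (casimir_pow_sub_mem_fil hs hq N))
      rw [← hl, ← hΩ, smul_sub, smul_smul, inv_mul_cancel_right₀ hl0, map_smul,
        smul_mul_assoc] at h
      convert h using 1
      abel
    have h := ih hlow
      (by rw [sub_mul, mul_sub, hY, smul_mul_assoc, mul_smul_comm, hcomm _ hYm])
      (by rw [sub_mul, mul_sub, hZ, smul_mul_assoc, mul_smul_comm, hcomm _ hZm])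
    simpa using add_mem h (Subalgebra.smul_mem _ hΩN (c * (l ^ N)⁻¹))

lemma center_Ug (hs : s ^ 2 = q) (hq : ∀ n : ℕ, 0 < n → q ^ n ≠ 1) :
    Subalgebra.center K (Ug q s) = Algebra.adjoin K {casimir q s hs} := by
  refine le_antisymm (fun z hz => ?_) (Algebra.adjoin_le
    (Set.singleton_subset_iff.2 (casimir_mem_center hs hq)))
  rw [Subalgebra.mem_center_iff] at hz
  obtain ⟨N, hN⟩ := exists_mem_fil z.2
  have h := mem_adjoin_of_commute hs hq N hN
    (congr_arg Subtype.val (hz (gO q s (Y q s) (Y_mem q s hs)))).symm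
    (congr_arg Subtype.val (hz (gO q s (Z q s) (Z_mem q s hs)))).symm
  have hmap : Algebra.adjoin K {(casimir q s hs : Double q s)} =
      (Algebra.adjoin K {casimir q s hs}).map (Ug q s).val := by
    rw [AlgHom.map_adjoin_singleton]
    rfl
  rw [hmap] at h
  obtain ⟨z', hz', hzz⟩ := h
  rwa [← Subtype.ext hzz]

lemma transcendental_casimir (hs : s ^ 2 = q) (hq : ∀ n : ℕ, 0 < n → q ^ n ≠ 1) :
    Transcendental K (casimir q s hs) := by
  have hZm : Z q s ∈ invSubalgebra q s := Z_mem q s hs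
  rw [transcendental_iff]
  intro p hp
  by_contra hp0
  set N := p.natDegree
  have h0 : Polynomial.aeval (casimir q s hs : Double q s) p = 0 := by
    have := congr_arg (Ug q s).val hp
    rwa [← Polynomial.aeval_algHom_apply, map_zero] at this
  have hmem : ∀ n < N, (casimir q s hs : Double q s) ^ n ∈ fil q s N := fun n hn => by
    have h := add_mem (fil_mono hn.le (casimir_pow_sub_mem_fil hs hq n))
      (Submodule.smul_mem _ (((q : K) - (q : K)⁻¹) ^ n)
        (ofO_mul_pow_mem_fil (pow_mem hZm n) hn))
    rwa [sub_add_cancel] at h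
  rw [Polynomial.aeval_eq_sum_range, Finset.sum_range_succ] at h0
  have h1 : p.leadingCoeff • (casimir q s hs : Double q s) ^ N ∈ fil q s N := by
    rw [Polynomial.leadingCoeff, ← neg_eq_of_add_eq_zero_right h0]
    exact neg_mem (sum_mem fun n hn => Submodule.smul_mem _ _ (hmem n (Finset.mem_range.1 hn)))
  have h2 := sub_mem h1
    (Submodule.smul_mem _ p.leadingCoeff (casimir_pow_sub_mem_fil hs hq N))
  rw [smul_sub, sub_sub_cancel, smul_smul, ← smul_mul_assoc, ← map_smul] at h2
  have h3 := eq_zero_of_ofO_mul_theta_pow_mem hq h2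
  obtain ⟨c, hc, h⟩ := pair_Z_pow_self hs hq N
  have h4 : Z q s ^ N = 0 := (smul_eq_zero.1 h3).resolve_left (mul_ne_zero
    (Polynomial.leadingCoeff_ne_zero.2 hp0) (pow_ne_zero _ (q_sub_inv_ne_zero hq)))
  apply hc
  rw [← h 0, h4, Subalgebra.coe_zero, pair_zero]

end QSL2R

end
theorem mainTheorem5 {K : Type*} [Field K] [StarRing K] [Algebra ℂ K] [StarModule ℂ K]
    (q s : Kˣ) (hs : s ^ 2 = q) (hsa : IsSelfAdjoint (s : K))
    (hq : ∀ n : ℕ, 0 < n → q ^ n ≠ 1) :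
    Subalgebra.center K (QSL2R.Ug q s) = Algebra.adjoin K {QSL2R.casimir q s hs} ∧
      Transcendental K (QSL2R.casimir q s hs) :=
  ⟨QSL2R.center_Ug hs hq, QSL2R.transcendental_casimir hs hq⟩
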